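/- Let $M$ be a connected Hausdorff smooth finite-dimensional manifold (without boundary), $\mathfrak g$ a finite-dimensional real Lie algebra, and $\zeta:\mathfrak g\to\mathfrak X(M)$ a Lie algebra homomorphism into the smooth vector fields on $M$ that is injective (effective) and transitive, i.e. $X\mapsto\zeta_X(x)$ maps $\mathfrak g$ onto $T_xM$ for every $x\in M$. Let $\Gamma(\mathfrak g)$ be the pseudogroup of diffeomorphisms between connected open subsets of $M$ that near each point of their domain are finite compositions of local flows $\mathrm{Fl}^{\zeta_X}_t$, $X\in\mathfrak g$. Fix $x_0\in M$. Let $P_{x_0}(\mathfrak g)$ be the set of germs at $x_0$ of elements of $\Gamma(\mathfrak g)$ defined at $x_0$, with the smooth structure whose smooth curves are locally of the form $t\mapsto\mathrm{germ}_{x_0}\Phi_t$ for smooth maps $(t,x)\mapsto\Phi_t(x)$ on $S\times U$ with $\Phi_t|_U\in\Gamma(\mathfrak g)$ ($S\subset\mathbb R$ open, $U$ a connected open neighbourhood of $x_0$); a tangent vector at $\varphi\in P_{x_0}(\mathfrak g)$ is the germ at $x_0$ of a vector field $\partial_t|_0\Phi_t$ along $\varphi=\mathrm{germ}_{x_0}\Phi_0$.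 Let $\mathrm{ev}_{x_0}:P_{x_0}(\mathfrak g)\to M$, $\varphi\mapsto\varphi(x_0)$, let $\Gamma(\mathfrak g)_{x_0}=\{\psi\in P_{x_0}(\mathfrak g):\psi(x_0)=x_0\}$ be the isotropy group and $\mathfrak g_{x_0}=\{X\in\mathfrak g:\zeta_X(x_0)=0\}$ the isotropy algebra. Then $\mathrm{ev}_{x_0}$ is surjective, and for each $\varphi\in P_{x_0}(\mathfrak g)$ there is a unique Lie algebra automorphism $\mathrm{Ad}(\varphi)$ of $\mathfrak g$ with $T\varphi\circ\zeta_X=\zeta_{\mathrm{Ad}(\varphi)X}\circ\varphi$ near $x_0$ for all $X\in\mathfrak g$. For each $X\in\mathfrak g$, $\hat\zeta^P_X(\varphi):=T\varphi\circ\zeta_X$ is a smooth vector field on $P_{x_0}(\mathfrak g)$. The normalizer $$N_{\mathfrak g}(\Gamma(\mathfrak g)_{x_0})=\{X\in\mathfrak g:\mathrm{Ad}(\psi)X-X\in\mathfrak g_{x_0}\text{ for all }\psi\in\Gamma(\mathfrak g)_{x_0}\}$$ is a Lie subalgebra of $\mathfrak g$ that contains $\mathfrak g_{x_0}$ as an ideal,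 and with $\hat{\mathfrak g}:=N_{\mathfrak g}(\Gamma(\mathfrak g)_{x_0})/\mathfrak g_{x_0}$ the formula $$\hat\zeta_X(\varphi(x_0)):=T\varphi.\zeta_X(x_0)=\zeta_{\mathrm{Ad}(\varphi)X}(\varphi(x_0)),\qquad \varphi\in P_{x_0}(\mathfrak g),$$ gives a well-defined linear map $\hat\zeta:\hat{\mathfrak g}\to\mathfrak X(M)$ with $\hat\zeta_{[X,Y]}=-[\hat\zeta_X,\hat\zeta_Y]$. Moreover: 1. The centralizer $Z_{\mathfrak X(M)}(\mathfrak g)=\{\eta\in\mathfrak X(M):[\eta,\zeta_X]=0\text{ for all }X\in\mathfrak g\}$ equals $\hat\zeta(\hat{\mathfrak g})$. 2. $Z_{\mathfrak X(M)}(\mathfrak g)$ is exactly the set of vector fields $\eta\in\mathfrak X(M)$ such that for some $X\in\mathfrak g$ the field $\hat\zeta^P_X$ projects to $\eta$, i.e. $T\mathrm{ev}_{x_0}\circ\hat\zeta^P_X=\eta\circ\mathrm{ev}_{x_0}$. 3. Let $X\in N_{\mathfrak g}(\Gamma(\mathfrak g)_{x_0})$, let $\varphi\in\Gamma(\mathfrak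 g)$, and let $t\in\mathbb R$ be such that $\mathrm{Fl}^{\zeta_X}_s(x_0)$ is defined and lies in the domain of $\varphi$ for all $s$ between $0$ and $t$. Then $\mathrm{Fl}^{\hat\zeta_X}_t(\varphi(x_0))$ is defined and equals $\varphi(\mathrm{Fl}^{\zeta_X}_t(x_0))$. -/

import Mathlib

open Set Filter Topology Manifold VectorField
open scoped ContDiff Bundle

noncomputable section

namespace GManifold

section Fields

variable {E : Type*} [NormedAddCommGroup E] [NormedSpace ℝ E]
  {M : Type*} [TopologicalSpace M] [ChartedSpace E M] [IsManifold 𝓘(ℝ, E) ∞ M]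

variable (E M) in
/-- The space of smooth vector fields on `M`. -/
abbrev VField : Type _ :=
  ContMDiffSection 𝓘(ℝ, E) E ∞ (fun x : M => TangentSpace 𝓘(ℝ, E) x)

theorem VField.mdiff (V : VField E M) (x : M) :
    MDifferentiableAt 𝓘(ℝ, E) (𝓘(ℝ, E).tangent)
      (fun y => (⟨y, V y⟩ : TangentBundle 𝓘(ℝ, E) M)) x :=
  (V.contMDiff x).mdifferentiableAt (by simp)

variable [FiniteDimensional ℝ E]

/-- The usual Lie bracket of vector fields. -/
instance : Bracket (VField E M) (VField E M) where
  bracket V W :=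
    ⟨mlieBracket 𝓘(ℝ, E) V W, by
      have := FiniteDimensional.complete ℝ E
      have : IsManifold 𝓘(ℝ, E) (((⊤ : ℕ∞) : WithTop ℕ∞) + 1) M :=
        (inferInstance : IsManifold 𝓘(ℝ, E) ∞ M)
      have : IsManifold 𝓘(ℝ, E) (minSmoothness ℝ 2) M := by
        simp only [minSmoothness_of_isRCLikeNormedField]
        infer_instance
      intro x
      exact ContMDiffAt.mlieBracket_vectorField (n := ⊤) (m := ⊤)
        (V.contMDiff x) (W.contMDiff x) (by simp)⟩

theorem VField.bracket_apply (V W : VField E M) (x : M) :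
    ⁅V, W⁆ x = mlieBracket 𝓘(ℝ, E) V W x := rfl

instance : LieRing (VField E M) where
  add_lie U V W := by
    ext x
    exact mlieBracket_add_left (U.mdiff x) (V.mdiff x)
  lie_add U V W := by
    ext x
    exact mlieBracket_add_right (V.mdiff x) (W.mdiff x)
  lie_self V := by
    ext x
    simp [VField.bracket_apply]
  leibniz_lie U V W := by
    have := FiniteDimensional.complete ℝ E
    have : IsManifold 𝓘(ℝ, E) (minSmoothness ℝ 3) M := by
      simp only [minSmoothness_of_isRCLikeNormedField]
      infer_instance
    ext x
    have h : minSmoothness ℝ 2 ≤ (∞ : WithTop ℕ∞) := by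
      simp only [minSmoothness_of_isRCLikeNormedField]
      exact WithTop.coe_le_coe.mpr le_top
    exact leibniz_identity_mlieBracket_apply ((U.contMDiff x).of_le h)
      ((V.contMDiff x).of_le h) ((W.contMDiff x).of_le h)

instance : LieAlgebra ℝ (VField E M) where
  lie_smul c V W := by
    ext x
    exact mlieBracket_const_smul_right (W.mdiff x)

/-- The flow relation: the integral curve of `V` that starts at `x` is defined up to time `t`
and is at `y` at time `t`. -/
def FlowsTo (V : VField E M) (t : ℝ) (x y : M) : Prop :=
  ∃ c : ℝ → M, c 0 = x ∧ c t = y ∧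
    IsMIntegralCurveOn (I := 𝓘(ℝ, E)) c (fun z => V z) (uIcc 0 t)

end Fields

section Action

variable {E : Type*} [NormedAddCommGroup E] [NormedSpace ℝ E] [FiniteDimensional ℝ E]
  {M : Type*} [TopologicalSpace M] [ChartedSpace E M] [IsManifold 𝓘(ℝ, E) ∞ M]
  {𝔤 : Type*} [LieRing 𝔤] [LieAlgebra ℝ 𝔤]

/-- An action `ζ : 𝔤 → 𝔛(M)` is effective if it is injective. -/
def IsEffective (ζ : 𝔤 →ₗ⁅ℝ⁆ VField E M) : Prop := Function.Injective ζ

/-- An action is transitive if its fundamental fields span every tangent space. -/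
def IsTransitive (ζ : 𝔤 →ₗ⁅ℝ⁆ VField E M) : Prop :=
  ∀ x : M, Function.Surjective (fun X : 𝔤 => ζ X x)

/-- Finite compositions of local flows of fundamental fields on open sets:
`Fl^{ζ_{X_n}}_{t_n} ∘ ⋯ ∘ Fl^{ζ_{X_1}}_{t_1} | U`. -/
inductive IsFlowComposite (ζ : 𝔤 →ₗ⁅ℝ⁆ VField E M) : OpenPartialHomeomorph M M → Prop
  | flow (X : 𝔤) (t : ℝ) (e : OpenPartialHomeomorph M M)
      (h : ∀ x ∈ e.source, FlowsTo (ζ X) t x (e x)) : IsFlowComposite ζ e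
  | comp (e e' : OpenPartialHomeomorph M M) (h : IsFlowComposite ζ e)
      (h' : IsFlowComposite ζ e') : IsFlowComposite ζ (e.trans e')

/-- The pseudogroup `Γ(𝔤)`: the diffeomorphisms between connected open subsets of `M` that near
each point of their domain are compositions of local flows of fundamental fields. -/
def pseudogroup (ζ : 𝔤 →ₗ⁅ℝ⁆ VField E M) : Set (OpenPartialHomeomorph M M) :=
  {e | IsConnected e.source ∧
    ∀ x ∈ e.source, ∃ e', IsFlowComposite ζ e' ∧ x ∈ e'.source ∧ (e : M → M) =ᶠ[𝓝 x] e'}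

/-- `P_{x₀}(𝔤)`: the set of germs at `x₀` of the elements of `Γ(𝔤)` defined at `x₀`. -/
def germSpace (ζ : 𝔤 →ₗ⁅ℝ⁆ VField E M) (x₀ : M) : Set ((𝓝 x₀).Germ M) :=
  {φ | ∃ e ∈ pseudogroup ζ, x₀ ∈ e.source ∧ φ = ((e : M → M) : (𝓝 x₀).Germ M)}

/-- The isotropy group `Γ(𝔤)_{x₀}`: the germs in `P_{x₀}(𝔤)` that fix `x₀`. -/
def isotropyGroup (ζ : 𝔤 →ₗ⁅ℝ⁆ VField E M) (x₀ : M) : Set ((𝓝 x₀).Germ M) :=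
  {ψ | ψ ∈ germSpace ζ x₀ ∧ ψ.value = x₀}

/-- The isotropy algebra `𝔤_{x₀} = {X | ζ_X(x₀) = 0}`. -/
def isotropyAlgebra (ζ : 𝔤 →ₗ⁅ℝ⁆ VField E M) (x₀ : M) : LieSubalgebra ℝ 𝔤 where
  carrier := {X | ζ X x₀ = 0}
  add_mem' {X Y} hX hY := by
    simp only [mem_ofPred_eq] at hX hY ⊢
    rw [map_add, ContMDiffSection.coe_add, Pi.add_apply, hX, hY, add_zero]
  zero_mem' := by
    simp only [mem_ofPred_eq]
    rw [map_zero]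
    rfl
  smul_mem' c X hX := by
    simp only [mem_ofPred_eq] at hX ⊢
    rw [map_smul, ContMDiffSection.coe_smul, Pi.smul_apply, hX, smul_zero]
  lie_mem' {X Y} hX hY := by
    simp only [mem_ofPred_eq] at hX hY ⊢
    rw [LieHom.map_lie, VField.bracket_apply, ← mlieBracketWithin_univ]
    exact mlieBracketWithin_eq_zero_of_eq_zero hX hY

/-- `Tφ ∘ V`, for the germ `φ` at `x₀` of a map and a vector field `V`: the germ at `x₀` of
`x ↦ T_xφ (V x)`, a vector field along `φ`. -/
def push {x₀ : M} (φ : (𝓝 x₀).Germ M) (V : VField E M) :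
    (𝓝 x₀).Germ (TangentBundle 𝓘(ℝ, E) M) :=
  Germ.liftOn φ
    (fun f => ((fun x => (⟨f x, mfderiv 𝓘(ℝ, E) 𝓘(ℝ, E) f x (V x)⟩ :
      TangentBundle 𝓘(ℝ, E) M)) : (𝓝 x₀).Germ (TangentBundle 𝓘(ℝ, E) M)))
    (fun f f' hf => Germ.coe_eq.mpr <| by
      filter_upwards [hf.eventuallyEq_nhds] with x hx
      rw [hx.mfderiv_eq]
      exact congrArg
        (fun y => (⟨y, mfderiv 𝓘(ℝ, E) 𝓘(ℝ, E) f' x (V x)⟩ : TangentBundle 𝓘(ℝ, E) M))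
        hx.eq_of_nhds)

/-- `V ∘ φ`, for the germ `φ` at `x₀` of a map and a vector field `V`: a vector field
along `φ`. -/
def along {x₀ : M} (V : VField E M) (φ : (𝓝 x₀).Germ M) :
    (𝓝 x₀).Germ (TangentBundle 𝓘(ℝ, E) M) :=
  φ.map (fun y => (⟨y, V y⟩ : TangentBundle 𝓘(ℝ, E) M))

/-- The defining property of `A = Ad(φ)`: it is an automorphism of `𝔤` with
`Tφ ∘ ζ_X = ζ_{A X} ∘ φ` near `x₀`, that is, `φ^* ζ_X = ζ_{Ad(φ⁻¹) X}`, for all `X`. -/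
def IsAd (ζ : 𝔤 →ₗ⁅ℝ⁆ VField E M) {x₀ : M} (φ : (𝓝 x₀).Germ M) (A : 𝔤 ≃ₗ⁅ℝ⁆ 𝔤) : Prop :=
  ∀ X : 𝔤, push φ (ζ X) = along (ζ (A X)) φ

/-- The automorphism `Ad(φ)` of `𝔤`. -/
def Ad (ζ : 𝔤 →ₗ⁅ℝ⁆ VField E M) {x₀ : M} (φ : (𝓝 x₀).Germ M) : 𝔤 ≃ₗ⁅ℝ⁆ 𝔤 :=
  @Classical.epsilon (𝔤 ≃ₗ⁅ℝ⁆ 𝔤) ⟨LieEquiv.refl⟩ (IsAd ζ φ)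

/-- The normalizer `N_𝔤(Γ(𝔤)_{x₀})` of the isotropy group in `𝔤`. -/
def normalizer (ζ : 𝔤 →ₗ⁅ℝ⁆ VField E M) (x₀ : M) : Set 𝔤 :=
  {X | ∀ ψ ∈ isotropyGroup ζ x₀, Ad ζ ψ X - X ∈ isotropyAlgebra ζ x₀}

/-- The centralizer of `ζ(𝔤)` in the Lie algebra of all smooth vector fields. -/
def centralizer (ζ : 𝔤 →ₗ⁅ℝ⁆ VField E M) : Set (VField E M) :=
  {η | ∀ X : 𝔤, ⁅η, ζ X⁆ = 0}

/-- Smooth families `t ↦ Φ_t`, `t ∈ S`, of elements of `Γ(𝔤)` with common domain `U ∋ x₀`.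
The smooth structure of `P_{x₀}(𝔤)` is the one whose smooth curves are, locally in `t`, the
curves `t ↦ germ_{x₀} Φ_t` given by such families. -/
structure IsSmoothFamily (ζ : 𝔤 →ₗ⁅ℝ⁆ VField E M) (x₀ : M) (S : Set ℝ) (U : Set M)
    (Φ : ℝ → M → M) : Prop where
  isOpen_times : IsOpen S
  isOpen_domain : IsOpen U
  base_mem : x₀ ∈ U
  smooth : ContMDiffOn (𝓘(ℝ, ℝ).prod 𝓘(ℝ, E)) 𝓘(ℝ, E) ∞
    (fun p : ℝ × M => Φ p.1 p.2) (S ×ˢ U)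
  mem : ∀ t ∈ S, ∃ e ∈ pseudogroup ζ, e.source = U ∧ EqOn e (Φ t) U

/-- `T_φ P_{x₀}(𝔤)`: the velocities `∂_t|₀ Φ_t` of the smooth curves in `P_{x₀}(𝔤)` that are
at `φ` at time `0`; they are germs at `x₀` of vector fields along `φ`. -/
def tangentP (ζ : 𝔤 →ₗ⁅ℝ⁆ VField E M) (x₀ : M) (φ : germSpace ζ x₀) :
    Set ((𝓝 x₀).Germ (TangentBundle 𝓘(ℝ, E) M)) :=
  {v | ∃ (S : Set ℝ) (U : Set M) (Φ : ℝ → M → M), IsSmoothFamily ζ x₀ S U Φ ∧ 0 ∈ S ∧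
    φ.1 = (Φ 0 : (𝓝 x₀).Germ M) ∧
    v = ((fun x => (⟨Φ 0 x, mfderiv 𝓘(ℝ, ℝ) 𝓘(ℝ, E) (fun t : ℝ => Φ t x) 0 (1 : ℝ)⟩ :
      TangentBundle 𝓘(ℝ, E) M)) : (𝓝 x₀).Germ (TangentBundle 𝓘(ℝ, E) M))}

/-- `ξ` is a smooth vector field on `P_{x₀}(𝔤)`: its values are tangent vectors, and it maps
smooth curves in `P_{x₀}(𝔤)` to smooth curves of germs of vector fields along maps. -/
structure IsVFieldP (ζ : 𝔤 →ₗ⁅ℝ⁆ VField E M) (x₀ : M)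
    (ξ : germSpace ζ x₀ → (𝓝 x₀).Germ (TangentBundle 𝓘(ℝ, E) M)) : Prop where
  tangent : ∀ φ, ξ φ ∈ tangentP ζ x₀ φ
  smooth : ∀ (S : Set ℝ) (U : Set M) (Φ : ℝ → M → M), IsSmoothFamily ζ x₀ S U Φ →
    ∀ t₀ ∈ S, ∃ (S' : Set ℝ) (U' : Set M) (Ψ : ℝ → M → TangentBundle 𝓘(ℝ, E) M),
      IsOpen S' ∧ t₀ ∈ S' ∧ S' ⊆ S ∧ IsOpen U' ∧ x₀ ∈ U' ∧
      ContMDiffOn (𝓘(ℝ, ℝ).prod 𝓘(ℝ, E)) (𝓘(ℝ, E).tangent) ∞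
        (fun p : ℝ × M => Ψ p.1 p.2) (S' ×ˢ U') ∧
      ∀ t ∈ S', ∀ φ : germSpace ζ x₀, φ.1 = (Φ t : (𝓝 x₀).Germ M) →
        ξ φ = (Ψ t : (𝓝 x₀).Germ (TangentBundle 𝓘(ℝ, E) M))

/-- The dual action on `P_{x₀}(𝔤)`: `ζ̂^P_X(φ) = Tφ ∘ ζ_X`. -/
def dualField (ζ : 𝔤 →ₗ⁅ℝ⁆ VField E M) (x₀ : M) (X : 𝔤) (φ : germSpace ζ x₀) :
    (𝓝 x₀).Germ (TangentBundle 𝓘(ℝ, E) M) :=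
  push φ.1 (ζ X)

/-- The vector field `ξ` on `P_{x₀}(𝔤)` projects to the vector field `η` on `M` under
`ev_{x₀} : φ ↦ φ(x₀)`, that is, `T ev_{x₀} ∘ ξ = η ∘ ev_{x₀}`. The tangent map `T ev_{x₀}`
evaluates a vector field along `φ` at `x₀`. -/
def ProjectsTo (ζ : 𝔤 →ₗ⁅ℝ⁆ VField E M) (x₀ : M)
    (ξ : germSpace ζ x₀ → (𝓝 x₀).Germ (TangentBundle 𝓘(ℝ, E) M)) (η : VField E M) : Prop :=
  ∀ φ : germSpace ζ x₀, (ξ φ).value = ⟨φ.1.value, η φ.1.value⟩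

end Action

end GManifold

end

open Set Filter Topology Manifold VectorField
open scoped ContDiff Bundle

noncomputable section

namespace GManifold

/-! By transitivity and connectedness, finite compositions of flows of fundamental fields join `x₀`
to every point of `M` (`IsTransitive.exists_isFlowComposite`). A field that commutes with the action
is invariant under all these compositions. It is therefore determined by its value at `x₀`, and that
value is fixed by the derivative at `x₀` of every isotropy element. Conversely, a vector at `x₀`
fixed by these derivatives can be carried to every point along any composition of flows without
ambiguity. The resulting field is smooth because nearby points are reached by flow maps depending
smoothly on the point (`IsTransitive.exists_localSection`), and it commutes with the action because
it is invariant (`exists_mem_centralizer`). Since `Te.ζ_X(x₀) = ζ_{Ad(e)X}(e x₀)`, the fixed vectors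
are exactly the `ζ_X(x₀)` with `X` in the normalizer. So `ζhat` sends the class of `X` to the unique
field of the centralizer with value `ζ_X(x₀)` at `x₀`, and the remaining claims follow from this
uniqueness.

The automorphism `Ad` comes from the flow of `ζ_Y`, which carries `ζ_X` to `ζ_{exp(-t ad Y)X}`: such
a curve solves `W' = -[ζ_Y, W]`, and the first variational equation shows that every solution inside
a finite-dimensional span of fields is pushed forward by the flow (`IsTransported`). That `Ad` is
unique and preserves brackets requires a fundamental field to be determined by its germ at one point
(`germKernel_eq_bot`).

The analytic input is the smooth dependence of flows on initial values. It is obtained from the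
inverse function theorem on the Banach space of continuous curves, applied to the integral equation
of the flow. -/

set_option synthInstance.maxHeartbeats 400000

/-! ### Smoothness of the composition operator on spaces of continuous maps. -/

section CompositionOperator

universe u
variable {K : Type*} [TopologicalSpace K] [CompactSpace K]
  {E : Type u} [NormedAddCommGroup E] [NormedSpace ℝ E]
  {F : Type u} [NormedAddCommGroup F] [NormedSpace ℝ F]

variable (K E F) in
/-- Pointwise application of a continuous family of continuous linear maps to a continuous
map. -/
def pointwiseApply : C(K, E →L[ℝ] F) →L[ℝ] C(K, E) →L[ℝ] C(K, F) :=
  LinearMap.mkContinuous₂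
    (LinearMap.mk₂ ℝ
      (fun (A : C(K, E →L[ℝ] F)) (h : C(K, E)) =>
        (⟨fun k => A k (h k), A.continuous.clm_apply h.continuous⟩ : C(K, F)))
      (fun A A' h => by ext k; simp) (fun c A h => by ext k; simp)
      (fun A h h' => by ext k; simp) (fun c A h => by ext k; simp)) 1 (by
    intro A h
    rw [ContinuousMap.norm_le _ (by positivity)]
    intro k
    simp only [LinearMap.mk₂_apply, ContinuousMap.coe_mk, one_mul]
    exact (A k).le_of_opNorm_le_of_le (A.norm_coe_le_norm k) (h.norm_coe_le_norm k))

@[simp]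
theorem pointwiseApply_apply (A : C(K, E →L[ℝ] F)) (h : C(K, E)) (k : K) :
    pointwiseApply K E F A h k = A k (h k) := rfl

/-- The composition operator of a smooth map is differentiable. -/
theorem hasFDerivAt_postcomp {v : E → F} (hv : ContDiff ℝ 1 v) (γ : C(K, E)) :
    HasFDerivAt (fun γ : C(K, E) => (⟨v, hv.continuous⟩ : C(E, F)).comp γ)
      (pointwiseApply K E F
        ((⟨fderiv ℝ v, hv.continuous_fderiv one_ne_zero⟩ : C(E, E →L[ℝ] F)).comp γ)) γ := by
  set D : C(E, E →L[ℝ] F) := ⟨fderiv ℝ v, hv.continuous_fderiv one_ne_zero⟩ with hD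
  have hc : Continuous (fun γ : C(K, E) => D.comp γ) := D.continuous_postcomp
  rw [hasFDerivAt_iff_isLittleO_nhds_zero, Asymptotics.isLittleO_iff]
  intro ε hε
  obtain ⟨δ, hδ, hδ'⟩ := (Metric.continuous_iff (α := C(K, E)) (β := C(K, E →L[ℝ] F))).mp
    hc γ ε hε
  filter_upwards [Metric.ball_mem_nhds (0 : C(K, E)) hδ] with h hh
  rw [mem_ball_zero_iff] at hh
  rw [ContinuousMap.norm_le _ (by positivity)]
  intro k
  -- A point of this segment is the value at `k` of the curve `γ + s • h`, which is `δ`-close to `γ`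
  -- in sup norm. Hence one `δ` serves all `k`.
  have key : ∀ z ∈ segment ℝ (γ k) (γ k + h k), ‖fderiv ℝ v z - fderiv ℝ v (γ k)‖ ≤ ε := by
    intro z hz
    rw [segment_eq_image'] at hz
    obtain ⟨s, hs, rfl⟩ := hz
    have h1 : dist (γ + s • h) γ < δ := by
      rw [dist_eq_norm, add_sub_cancel_left, norm_smul, Real.norm_of_nonneg hs.1]
      nlinarith [hs.2, norm_nonneg h]
    have h2 := (ContinuousMap.dist_apply_le_dist (f := D.comp (γ + s • h)) (g := D.comp γ)
      k).trans (hδ' _ h1).le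
    simpa [dist_eq_norm, hD] using h2
  have h3 := Convex.norm_image_sub_le_of_norm_hasFDerivWithin_le' (f := v)
    (fun z _ => ((hv.differentiable one_ne_zero z).hasFDerivAt).hasFDerivWithinAt) key
    (convex_segment _ _) (left_mem_segment ℝ _ _) (right_mem_segment ℝ (γ k) (γ k + h k))
  rw [add_sub_cancel_left] at h3
  refine le_trans (le_of_eq ?_) (h3.trans ?_)
  · simp [hD]
  · exact mul_le_mul_of_nonneg_left (h.norm_coe_le_norm k) hε.le

/-- The composition operator of a smooth map is smooth. -/
theorem contDiff_postcomp {v : E → F} (hv : ContDiff ℝ ∞ v) :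
    ContDiff ℝ ∞ (fun γ : C(K, E) => (⟨v, hv.continuous⟩ : C(E, F)).comp γ) := by
  rw [contDiff_infty]
  intro n
  -- The derivative is again built from a composition operator, now of `fderiv ℝ v` with values in
  -- `E →L[ℝ] F`. The target must therefore vary, and `E` and `F` share a universe so that it can.
  induction n generalizing F with
  | zero =>
    exact contDiff_zero.mpr (ContinuousMap.continuous_postcomp _)
  | succ n ih =>
    have h1 : ContDiff ℝ 1 v := hv.of_le (by simp)
    rw [Nat.cast_add, Nat.cast_one, contDiff_succ_iff_fderiv]
    refine ⟨fun γ => (hasFDerivAt_postcomp h1 γ).differentiableAt, by simp, ?_⟩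
    have h2 := ih (contDiff_infty_iff_fderiv.mp hv).2
    rw [show fderiv ℝ (fun γ : C(K, E) => (⟨v, hv.continuous⟩ : C(E, F)).comp γ) = _ from
      funext fun γ => (hasFDerivAt_postcomp h1 γ).fderiv]
    exact (pointwiseApply K E F).contDiff.comp h2

end CompositionOperator

/-! ### Smooth local flows of globally defined fields on a Banach space. -/

section LocalFlow

variable {E : Type*} [NormedAddCommGroup E] [NormedSpace ℝ E]

variable (E) in
/-- Integration `γ ↦ (s ↦ ∫₀ˢ γ)` of continuous curves on the unit interval. -/
def integrateCurve : C(Icc (0 : ℝ) 1, E) →L[ℝ] C(Icc (0 : ℝ) 1, E) :=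
  LinearMap.mkContinuous
    { toFun := fun γ => ⟨fun s => ∫ r in (0 : ℝ)..s, γ (projIcc 0 1 zero_le_one r),
        (intervalIntegral.continuous_primitive
          (fun a b => (γ.continuous.comp continuous_projIcc).intervalIntegrable a b) 0).comp
          continuous_subtype_val⟩
      map_add' := fun γ γ' => by
        ext s
        exact intervalIntegral.integral_add
          ((γ.continuous.comp continuous_projIcc).intervalIntegrable _ _)
          ((γ'.continuous.comp continuous_projIcc).intervalIntegrable _ _)
      map_smul' := fun c γ => by
        ext s
        exact intervalIntegral.integral_smul c _ } 1 (by
    intro γ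
    rw [ContinuousMap.norm_le _ (by positivity)]
    intro s
    have := intervalIntegral.norm_integral_le_of_norm_le_const (a := (0 : ℝ)) (b := s)
      (f := fun r => γ (projIcc 0 1 zero_le_one r)) (C := ‖γ‖)
      (fun r _ => γ.norm_coe_le_norm _)
    refine this.trans ?_
    rw [sub_zero, abs_of_nonneg s.2.1, mul_comm]
    exact mul_le_mul_of_nonneg_right s.2.2 (norm_nonneg _))

/-- The defect of the integral equation `γ(s) = x + τ ∫₀ˢ v(γ)`. -/
def integralDefect {v : E → E} (hv : ContDiff ℝ ∞ v)
    (q : (E × ℝ) × C(Icc (0 : ℝ) 1, E)) : C(Icc (0 : ℝ) 1, E) :=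
  q.2 - ContinuousLinearMap.const ℝ (Icc (0 : ℝ) 1) q.1.1
    - q.1.2 • integrateCurve E ((⟨v, hv.continuous⟩ : C(E, E)).comp q.2)

theorem contDiff_integralDefect {v : E → E} (hv : ContDiff ℝ ∞ v) :
    ContDiff ℝ ∞ (integralDefect hv) := by
  have h1 : ContDiff ℝ ∞ (fun q : (E × ℝ) × C(Icc (0 : ℝ) 1, E) =>
      integrateCurve E ((⟨v, hv.continuous⟩ : C(E, E)).comp q.2)) :=
    (integrateCurve E).contDiff.comp ((contDiff_postcomp hv).comp contDiff_snd)
  have h2 : ContDiff ℝ ∞ (fun q : (E × ℝ) × C(Icc (0 : ℝ) 1, E) =>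
      ContinuousLinearMap.const ℝ (Icc (0 : ℝ) 1) q.1.1) :=
    (ContinuousLinearMap.const ℝ (M := E) (Icc (0 : ℝ) 1)).contDiff.comp
      (contDiff_fst.comp contDiff_fst)
  exact (contDiff_snd.sub h2).sub ((contDiff_snd.comp contDiff_fst).smul h1)

theorem integralDefect_eq_zero_iff {v : E → E} (hv : ContDiff ℝ ∞ v) (x : E) (τ : ℝ)
    (γ : C(Icc (0 : ℝ) 1, E)) :
    integralDefect hv ((x, τ), γ) = 0 ↔ ∀ s : Icc (0 : ℝ) 1,
      γ s = x + τ • ∫ r in (0 : ℝ)..s, v (γ (projIcc 0 1 zero_le_one r)) := by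
  rw [ContinuousMap.ext_iff]
  refine forall_congr' fun s => ?_
  change γ s - x - τ • (∫ r in (0 : ℝ)..s, v (γ (projIcc 0 1 zero_le_one r))) = 0 ↔ _
  rw [sub_sub, sub_eq_zero]

/-- The derivative at `τ = 0` of the map `(p, γ) ↦ (p, defect)`. -/
def shear (B : (E × ℝ) →L[ℝ] C(Icc (0 : ℝ) 1, E)) :
    ((E × ℝ) × C(Icc (0 : ℝ) 1, E)) ≃L[ℝ] ((E × ℝ) × C(Icc (0 : ℝ) 1, E)) :=
  ContinuousLinearEquiv.equivOfInverse
    ((ContinuousLinearMap.fst ℝ _ _).prod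
      (ContinuousLinearMap.snd ℝ _ _ - B.comp (ContinuousLinearMap.fst ℝ _ _)))
    ((ContinuousLinearMap.fst ℝ _ _).prod
      (ContinuousLinearMap.snd ℝ _ _ + B.comp (ContinuousLinearMap.fst ℝ _ _)))
    (fun q => by simp) (fun q => by simp)

/-- At `τ = 0` the factor `τ` kills the derivative of the integral term in `γ`, so the partial
derivative of the defect in `γ` is the identity. The total derivative is then block triangular and
invertible with no smallness condition on `v`. -/
theorem exists_hasFDerivAt_shear {v : E → E} (hv : ContDiff ℝ ∞ v) (x₀ : E) :
    ∃ B : (E × ℝ) →L[ℝ] C(Icc (0 : ℝ) 1, E),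
      HasFDerivAt (fun q : (E × ℝ) × C(Icc (0 : ℝ) 1, E) => (q.1, integralDefect hv q))
        (shear B : _ →L[ℝ] _) ((x₀, 0), ContinuousMap.const _ x₀) := by
  set q₀ : (E × ℝ) × C(Icc (0 : ℝ) 1, E) := ((x₀, 0), ContinuousMap.const _ x₀)
  have h1 : ContDiff ℝ ∞ (fun q : (E × ℝ) × C(Icc (0 : ℝ) 1, E) =>
      integrateCurve E ((⟨v, hv.continuous⟩ : C(E, E)).comp q.2)) :=
    (integrateCurve E).contDiff.comp ((contDiff_postcomp hv).comp contDiff_snd)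
  have h2 := ((h1.differentiable (by simp)) q₀).hasFDerivAt
  have h3 : HasFDerivAt (fun q : (E × ℝ) × C(Icc (0 : ℝ) 1, E) => q.1.2)
      ((ContinuousLinearMap.snd ℝ E ℝ).comp (ContinuousLinearMap.fst ℝ _ _)) q₀ :=
    HasFDerivAt.comp q₀ (g := Prod.snd) hasFDerivAt_snd hasFDerivAt_fst
  have h4 : HasFDerivAt (fun q : (E × ℝ) × C(Icc (0 : ℝ) 1, E) =>
      ContinuousLinearMap.const ℝ (Icc (0 : ℝ) 1) q.1.1)
      ((ContinuousLinearMap.const ℝ (Icc (0 : ℝ) 1)).comp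
        ((ContinuousLinearMap.fst ℝ E ℝ).comp (ContinuousLinearMap.fst ℝ _ _))) q₀ :=
    HasFDerivAt.comp q₀ (g := ContinuousLinearMap.const ℝ (M := E) (Icc (0 : ℝ) 1))
      (ContinuousLinearMap.hasFDerivAt _)
      (HasFDerivAt.comp q₀ (g := Prod.fst) hasFDerivAt_fst hasFDerivAt_fst)
  have h5 := (hasFDerivAt_fst (𝕜 := ℝ) (p := q₀)).prodMk
    (((hasFDerivAt_snd (𝕜 := ℝ) (p := q₀)).sub h4).sub (h3.smul h2))
  refine ⟨(ContinuousLinearMap.const ℝ (Icc (0 : ℝ) 1)).comp (ContinuousLinearMap.fst ℝ E ℝ) +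
    (ContinuousLinearMap.snd ℝ E ℝ).smulRight
      (integrateCurve E ((⟨v, hv.continuous⟩ : C(E, E)).comp q₀.2)), ?_⟩
  refine h5.congr_fderiv ?_
  refine ContinuousLinearMap.ext fun q => Prod.ext rfl ?_
  change q.2 - ContinuousLinearMap.const ℝ (Icc (0 : ℝ) 1) q.1.1 -
      ((0 : ℝ) • _ + q.1.2 • integrateCurve E ((⟨v, hv.continuous⟩ : C(E, E)).comp q₀.2)) =
    q.2 - (ContinuousLinearMap.const ℝ (Icc (0 : ℝ) 1) q.1.1 +
      q.1.2 • integrateCurve E ((⟨v, hv.continuous⟩ : C(E, E)).comp q₀.2))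
  rw [zero_smul, zero_add, sub_sub]

variable [CompleteSpace E]

/-- Local solution of the integral equation, smooth in the initial value and the time scale. -/
theorem exists_contDiffOn_integralDefect_eq_zero {v : E → E} (hv : ContDiff ℝ ∞ v) (x₀ : E) :
    ∃ (ψ : E × ℝ → C(Icc (0 : ℝ) 1, E)) (δ : ℝ) (r : ℝ), 0 < δ ∧ 0 < r ∧
      ContDiffOn ℝ ∞ ψ (Metric.ball x₀ δ ×ˢ Metric.ball 0 δ) ∧
      (∀ p ∈ Metric.ball x₀ δ ×ˢ Metric.ball (0 : ℝ) δ,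
        ψ p ∈ Metric.ball (ContinuousMap.const _ x₀) r ∧ integralDefect hv (p, ψ p) = 0) ∧
      ∀ p ∈ Metric.ball x₀ δ ×ˢ Metric.ball (0 : ℝ) δ,
        ∀ γ ∈ Metric.ball (ContinuousMap.const _ x₀) r, integralDefect hv (p, γ) = 0 →
          γ = ψ p := by
  obtain ⟨B, hB⟩ := exists_hasFDerivAt_shear hv x₀
  set q₀ : (E × ℝ) × C(Icc (0 : ℝ) 1, E) := ((x₀, 0), ContinuousMap.const _ x₀) with hq₀
  set H : (E × ℝ) × C(Icc (0 : ℝ) 1, E) → (E × ℝ) × C(Icc (0 : ℝ) 1, E) :=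
    fun q => (q.1, integralDefect hv q) with hH
  have hHc : ContDiff ℝ ∞ H := contDiff_fst.prodMk (contDiff_integralDefect hv)
  let e := hHc.contDiffAt.toOpenPartialHomeomorph H hB (by simp)
  have heH : ∀ q, e q = H q := fun q => rfl
  have hq₀s : q₀ ∈ e.source := ContDiffAt.mem_toOpenPartialHomeomorph_source _ hB _
  have hHq₀ : H q₀ = ((x₀, 0), 0) := by
    refine Prod.ext rfl ?_
    change integralDefect hv ((x₀, 0), ContinuousMap.const _ x₀) = 0
    rw [integralDefect_eq_zero_iff]
    simp
  -- the points near which the inverse is smooth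
  have hinv : ∀ᶠ q in 𝓝 (H q₀), q ∈ e.target ∧ ContDiffAt ℝ ∞ e.symm q := by
    -- Invertible operators form an open set, so the derivative stays invertible near `q₀` and the
    -- inverse is smooth on a whole neighbourhood.
    have h1 : ∀ᶠ q in 𝓝 q₀, fderiv ℝ H q ∈ range ((↑) :
        (((E × ℝ) × C(Icc (0 : ℝ) 1, E)) ≃L[ℝ] ((E × ℝ) × C(Icc (0 : ℝ) 1, E))) →
          (((E × ℝ) × C(Icc (0 : ℝ) 1, E)) →L[ℝ] ((E × ℝ) × C(Icc (0 : ℝ) 1, E)))) := by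
      refine (hHc.continuous_fderiv (by simp)).continuousAt.eventually ?_
      rw [hB.fderiv]
      exact ContinuousLinearEquiv.nhds (shear B)
    have h2 : Tendsto e.symm (𝓝 (H q₀)) (𝓝 q₀) := e.tendsto_symm hq₀s
    filter_upwards [h2.eventually h1, e.open_target.mem_nhds (e.map_source hq₀s)] with q hq hqt
    obtain ⟨L, hL⟩ := hq
    refine ⟨hqt, e.contDiffAt_symm (f₀' := L) hqt ?_ hHc.contDiffAt⟩
    rw [hL]
    exact (hHc.differentiable (by simp) _).hasFDerivAt
  obtain ⟨r, hr, hrs⟩ := Metric.mem_nhds_iff.mp (e.open_source.mem_nhds hq₀s)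
  let ψ : E × ℝ → C(Icc (0 : ℝ) 1, E) := fun p => (e.symm (p, 0)).2
  have hcont : Continuous (fun p : E × ℝ => (p, (0 : C(Icc (0 : ℝ) 1, E)))) := by fun_prop
  have hev : ∀ᶠ p in 𝓝 ((x₀, 0) : E × ℝ), (p, (0 : C(Icc (0 : ℝ) 1, E))) ∈ e.target ∧
      ContDiffAt ℝ ∞ e.symm (p, 0) ∧
      ψ p ∈ Metric.ball (ContinuousMap.const _ x₀) r ∧ dist p (x₀, 0) < r := by
    have h1 : Tendsto (fun p : E × ℝ => (p, (0 : C(Icc (0 : ℝ) 1, E)))) (𝓝 (x₀, 0))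
        (𝓝 (H q₀)) := by
      rw [hHq₀]
      exact hcont.tendsto _
    have h2 : Tendsto ψ (𝓝 (x₀, 0)) (𝓝 (ContinuousMap.const _ x₀)) :=
      (continuous_snd.tendsto q₀).comp ((e.tendsto_symm hq₀s).comp h1)
    filter_upwards [h1.eventually hinv, h2.eventually (Metric.ball_mem_nhds _ hr),
      Metric.ball_mem_nhds _ hr] with p hp1 hp2 hp3
    exact ⟨hp1.1, hp1.2, hp2, hp3⟩
  obtain ⟨δ, hδ, hδs⟩ := Metric.mem_nhds_iff.mp hev
  rw [← ball_prod_same] at hδs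
  refine ⟨ψ, δ, r, hδ, hr, fun p hp => ?_, fun p hp => ?_, fun p hp γ hγ h0 => ?_⟩
  · have := (hδs hp).2.1
    exact (contDiffAt_snd.comp p (this.comp p
      (contDiffAt_id.prodMk contDiffAt_const))).contDiffWithinAt
  · refine ⟨(hδs hp).2.2.1, ?_⟩
    have h1 : H (e.symm (p, 0)) = (p, 0) := e.right_inv (hδs hp).1
    have h2 : (e.symm (p, 0)).1 = p := (Prod.ext_iff.mp h1).1
    have h3 : integralDefect hv (e.symm (p, 0)) = 0 := (Prod.ext_iff.mp h1).2
    rwa [show e.symm (p, 0) = (p, ψ p) from Prod.ext h2 rfl] at h3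
  · have h1 : (p, γ) ∈ e.source := by
      apply hrs
      rw [hq₀, ← ball_prod_same]
      exact ⟨(hδs hp).2.2.2, hγ⟩
    have h2 : e (p, γ) = (p, 0) := by rw [heH]; exact Prod.ext rfl h0
    have h3 := e.left_inv h1
    rw [h2] at h3
    change γ = (e.symm (p, 0)).2
    rw [h3]

/-- A globally defined smooth vector field on a Banach space has a smooth local flow. -/
theorem exists_contDiffOn_flow_of_contDiff {v : E → E} (hv : ContDiff ℝ ∞ v) (x₀ : E) :
    ∃ (α : ℝ × E → E) (δ : ℝ), 0 < δ ∧
      ContDiffOn ℝ ∞ α (Ioo (-δ) δ ×ˢ Metric.ball x₀ δ) ∧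
      (∀ x ∈ Metric.ball x₀ δ, α (0, x) = x) ∧
      ∀ t ∈ Ioo (-δ) δ, ∀ x ∈ Metric.ball x₀ δ,
        HasDerivAt (fun s => α (s, x)) (v (α (t, x))) t := by
  obtain ⟨ψ, δ, r, hδ, hr, hψ, hψ0, hψu⟩ := exists_contDiffOn_integralDefect_eq_zero hv x₀
  have hball : ∀ t, t ∈ Metric.ball (0 : ℝ) δ ↔ t ∈ Ioo (-δ) δ := by
    intro t
    rw [Real.ball_eq_Ioo, zero_sub, zero_add]
  let α : ℝ × E → E := fun p => ψ (p.2, p.1) ⟨1, right_mem_Icc.mpr zero_le_one⟩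
  have hα : ContDiffOn ℝ ∞ α (Ioo (-δ) δ ×ˢ Metric.ball x₀ δ) := by
    have h1 : ContDiffOn ℝ ∞ (fun p : ℝ × E => ψ (p.2, p.1))
        (Ioo (-δ) δ ×ˢ Metric.ball x₀ δ) :=
      hψ.comp (contDiff_snd.prodMk contDiff_fst).contDiffOn
        (fun p hp => ⟨hp.2, (hball _).mpr hp.1⟩)
    exact (ContinuousMap.evalCLM ℝ (⟨1, right_mem_Icc.mpr zero_le_one⟩ :
      Icc (0 : ℝ) 1)).contDiff.comp_contDiffOn h1
  -- shrinking the parameter interval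
  have hshrink : ∀ x ∈ Metric.ball x₀ δ, ∀ τ ∈ Ioo (-δ) δ, ∀ s : Icc (0 : ℝ) 1,
      ψ (x, τ) s = α (s * τ, x) := by
    intro x hx τ hτ s
    have hp : (x, τ) ∈ Metric.ball x₀ δ ×ˢ Metric.ball (0 : ℝ) δ := ⟨hx, (hball _).mpr hτ⟩
    have hτ' : (s : ℝ) * τ ∈ Metric.ball (0 : ℝ) δ := by
      have := hp.2
      rw [mem_ball_zero_iff] at this ⊢
      rw [norm_mul, Real.norm_of_nonneg s.2.1]
      nlinarith [s.2.2, norm_nonneg τ]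
    -- The solution with time scale `τ`, traversed at speed `s`, solves the equation with time scale
    -- `s * τ` and stays in the same ball of curves, so local uniqueness identifies the two.
    let γ : C(Icc (0 : ℝ) 1, E) := (ψ (x, τ)).comp ⟨fun r => s * r, by fun_prop⟩
    have hγ : γ = ψ (x, s * τ) := by
      refine hψu (x, s * τ) ⟨hx, hτ'⟩ γ ?_ ?_
      · have h1 := (hψ0 _ hp).1
        rw [Metric.mem_ball, ContinuousMap.dist_lt_iff hr] at h1 ⊢
        exact fun k => h1 _
      · rw [integralDefect_eq_zero_iff]
        intro σ
        have h1 := (integralDefect_eq_zero_iff hv _ _ _).mp (hψ0 _ hp).2 (s * σ)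
        change ψ (x, τ) (s * σ) = _
        rw [h1]
        congr 1
        rw [mul_comm (s : ℝ) τ, mul_smul]
        congr 1
        have h2 := intervalIntegral.smul_integral_comp_mul_left (a := 0) (b := (σ : ℝ))
          (fun r => v (ψ (x, τ) (projIcc 0 1 zero_le_one r))) (s : ℝ)
        rw [mul_zero] at h2
        change ∫ r in (0 : ℝ)..(s * σ : ℝ), _ = _
        rw [← h2]
        congr 1
        refine intervalIntegral.integral_congr fun r hr => ?_
        rw [uIcc_of_le σ.2.1] at hr
        have hr' : r ∈ Icc (0 : ℝ) 1 := ⟨hr.1, hr.2.trans σ.2.2⟩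
        change v (ψ (x, τ) (projIcc 0 1 zero_le_one (s * r))) =
          v (ψ (x, τ) (s * projIcc 0 1 zero_le_one r))
        rw [projIcc_of_mem _ hr', projIcc_of_mem _ (unitInterval.mul_mem s.2 hr')]
        rfl
    have h3 := DFunLike.congr_fun hγ ⟨1, right_mem_Icc.mpr zero_le_one⟩
    change ψ (x, τ) (s * 1) = ψ (x, s * τ) _ at h3
    rwa [mul_one] at h3
  -- The substitution `r ↦ r * τ` turns the equation on the unit interval into the usual integral
  -- equation, which can be differentiated in `τ`.
  have hint : ∀ x ∈ Metric.ball x₀ δ, ∀ τ ∈ Ioo (-δ) δ,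
      α (τ, x) = x + ∫ r in (0 : ℝ)..τ, v (α (r, x)) := by
    intro x hx τ hτ
    have h1 := (integralDefect_eq_zero_iff hv _ _ _).mp
      (hψ0 (x, τ) ⟨hx, (hball _).mpr hτ⟩).2 ⟨1, right_mem_Icc.mpr zero_le_one⟩
    change α (τ, x) = _ at h1
    rw [h1]
    congr 1
    have h2 := intervalIntegral.smul_integral_comp_mul_right (a := 0) (b := 1)
      (fun r => v (α (r, x))) τ
    rw [zero_mul, one_mul] at h2
    rw [← h2]
    congr 1
    refine intervalIntegral.integral_congr fun r hr => ?_
    rw [uIcc_of_le zero_le_one] at hr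
    rw [projIcc_of_mem _ hr, hshrink x hx τ hτ]
  refine ⟨α, δ, hδ, hα, fun x hx => ?_, fun t ht x hx => ?_⟩
  · rw [hint x hx 0 ⟨by linarith, hδ⟩, intervalIntegral.integral_same, add_zero]
  · have hc : ContinuousOn (fun s => v (α (s, x))) (Ioo (-δ) δ) :=
      hv.continuous.comp_continuousOn (hα.continuousOn.comp (by fun_prop)
        (fun s hs => ⟨hs, hx⟩))
    have hsub : uIcc 0 t ⊆ Ioo (-δ) δ := by
      exact ordConnected_Ioo.uIcc_subset ⟨by linarith, hδ⟩ ht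
    have h1 : HasDerivAt (fun s => x + ∫ r in (0 : ℝ)..s, v (α (r, x))) (v (α (t, x))) t := by
      refine HasDerivAt.const_add x ?_
      refine intervalIntegral.integral_hasDerivAt_right
        ((hc.mono hsub).intervalIntegrable) ?_ (hc.continuousAt (Ioo_mem_nhds ht.1 ht.2))
      exact hc.stronglyMeasurableAtFilter isOpen_Ioo t ht
    refine h1.congr_of_eventuallyEq ?_
    filter_upwards [Ioo_mem_nhds ht.1 ht.2] with s hs
    exact hint x hx s hs

end LocalFlow

/-! ### Local flows on open sets, the variational equation and transport of fields. -/

section LocalODE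

variable {E : Type*} [NormedAddCommGroup E] [NormedSpace ℝ E]

/-- A smooth vector field on an open subset of a finite-dimensional space has a smooth local
flow. -/
theorem exists_contDiffOn_flow [FiniteDimensional ℝ E] {v : E → E} {Ω : Set E} (hΩ : IsOpen Ω)
    (hv : ContDiffOn ℝ ∞ v Ω) {x₀ : E} (hx₀ : x₀ ∈ Ω) :
    ∃ (α : ℝ × E → E) (δ : ℝ), 0 < δ ∧
      ContDiffOn ℝ ∞ α (Ioo (-δ) δ ×ˢ Metric.ball x₀ δ) ∧
      (∀ x ∈ Metric.ball x₀ δ, α (0, x) = x) ∧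
      ∀ t ∈ Ioo (-δ) δ, ∀ x ∈ Metric.ball x₀ δ,
        α (t, x) ∈ Ω ∧ HasDerivAt (fun s => α (s, x)) (v (α (t, x))) t := by
  have := FiniteDimensional.complete ℝ E
  obtain ⟨ρ, hρ, hρΩ⟩ := Metric.mem_nhds_iff.mp (hΩ.mem_nhds hx₀)
  -- The cut-off makes the field global. The flow is later restricted to times and points for which
  -- it stays in the ball of radius `ρ / 4`, where the cut-off is 1.
  let f : ContDiffBump x₀ := ⟨ρ / 4, ρ / 2, by positivity, by linarith⟩
  have hv' : ContDiff ℝ ∞ (fun x => f x • v x) := by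
    rw [contDiff_iff_contDiffAt]
    intro x
    by_cases hx : x ∈ Metric.ball x₀ ρ
    · exact f.contDiffAt.smul (hv.contDiffAt (hΩ.mem_nhds (hρΩ hx)))
    · refine (contDiffAt_const (c := (0 : E))).congr_of_eventuallyEq ?_
      have h1 : x ∈ (Metric.closedBall x₀ (ρ / 2))ᶜ := by
        rw [mem_compl_iff, Metric.mem_closedBall]
        rw [Metric.mem_ball] at hx
        linarith
      filter_upwards [Metric.isClosed_closedBall.isOpen_compl.mem_nhds h1] with z hz
      rw [f.zero_of_le_dist (le_of_not_ge fun h => hz (Metric.mem_closedBall.mpr h)), zero_smul]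
  obtain ⟨α, δ, hδ, hα, hα0, hαv⟩ := exists_contDiffOn_flow_of_contDiff hv' x₀
  have hc : ContinuousAt α (0, x₀) := hα.continuousOn.continuousAt
    (prod_mem_nhds (Ioo_mem_nhds (by linarith) hδ) (Metric.ball_mem_nhds _ hδ))
  have h1 : ∀ᶠ p in 𝓝 ((0, x₀) : ℝ × E), α p ∈ Metric.ball x₀ (ρ / 4) := by
    refine hc.eventually (Metric.isOpen_ball.mem_nhds ?_)
    rw [hα0 x₀ (Metric.mem_ball_self hδ)]
    exact Metric.mem_ball_self (by positivity)
  obtain ⟨δ', hδ', hsub⟩ := Metric.mem_nhds_iff.mp h1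
  rw [← ball_prod_same] at hsub
  have hI : Ioo (-(min δ δ')) (min δ δ') ⊆ Ioo (-δ) δ := by
    intro t ht
    exact ⟨by linarith [ht.1, min_le_left δ δ'], ht.2.trans_le (min_le_left _ _)⟩
  have hB : Metric.ball x₀ (min δ δ') ⊆ Metric.ball x₀ δ :=
    Metric.ball_subset_ball (min_le_left _ _)
  refine ⟨α, min δ δ', lt_min hδ hδ', hα.mono (prod_mono hI hB), fun x hx => hα0 x (hB hx),
    fun t ht x hx => ?_⟩
  have h2 : α (t, x) ∈ Metric.ball x₀ (ρ / 4) := by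
    refine hsub (show (t, x) ∈ Metric.ball 0 δ' ×ˢ Metric.ball x₀ δ' from
      ⟨?_, Metric.ball_subset_ball (min_le_right _ _) hx⟩)
    rw [Real.ball_eq_Ioo]
    exact ⟨by linarith [ht.1, min_le_right δ δ'], by linarith [ht.2, min_le_right δ δ']⟩
  refine ⟨hρΩ (Metric.ball_subset_ball (by linarith) h2), ?_⟩
  have h3 := hαv t (hI ht) x (hB hx)
  rwa [f.one_of_mem_closedBall (Metric.ball_subset_closedBall h2), one_smul] at h3

/-- Uniqueness for linear differential equations. -/
theorem eqOn_Ioo_of_linear_ode {p q : ℝ → E} {B : ℝ → E →L[ℝ] E} {δ : ℝ}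
    (hB : ContinuousOn B (Ioo (-δ) δ))
    (hp : ∀ t ∈ Ioo (-δ) δ, HasDerivAt p (B t (p t)) t)
    (hq : ∀ t ∈ Ioo (-δ) δ, HasDerivAt q (B t (q t)) t) (h0 : p 0 = q 0) :
    EqOn p q (Ioo (-δ) δ) := by
  intro t ht
  -- On the compact interval `[-a, a]` the operators are bounded, which gives one Lipschitz constant
  -- for all times.
  obtain ⟨a, hta, haδ⟩ := exists_between (abs_lt.mpr ht)
  have ha : 0 < a := (abs_nonneg t).trans_lt hta
  have hsub : Icc (-a) a ⊆ Ioo (-δ) δ := fun s hs => ⟨by linarith [hs.1], by linarith [hs.2]⟩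
  obtain ⟨C, hC⟩ := isCompact_Icc.exists_bound_of_continuousOn (hB.mono hsub)
  have hsub' : Ioo (-a) a ⊆ Ioo (-δ) δ := Ioo_subset_Icc_self.trans hsub
  refine ODE_solution_unique_of_mem_Ioo (v := fun t x => B t x) (s := fun _ => univ)
    (K := C.toNNReal) (t₀ := 0) (a := -a) (b := a) (fun s hs => ?_) ⟨by linarith, ha⟩
    (fun s hs => ⟨hp s (hsub' hs), mem_univ _⟩) (fun s hs => ⟨hq s (hsub' hs), mem_univ _⟩) h0
    (abs_lt.mp hta)
  refine ((B s).lipschitz.weaken ?_).lipschitzOnWith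
  rw [← NNReal.coe_le_coe, coe_nnnorm]
  exact (hC s (Ioo_subset_Icc_self hs)).trans (Real.le_coe_toNNReal C)

variable {v : E → E} {Ω U : Set E} {α : ℝ × E → E} {δ : ℝ}

theorem fderiv_partial_right {f : ℝ × E → E} {t : ℝ} {x : E} (hf : DifferentiableAt ℝ f (t, x))
    (w : E) : fderiv ℝ (fun y => f (t, y)) x w = fderiv ℝ f (t, x) (0, w) := by
  have h1 : HasFDerivAt (fun y : E => ((t, y) : ℝ × E)) (ContinuousLinearMap.inr ℝ ℝ E) x :=
    hasFDerivAt_prodMk_right t x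
  exact DFunLike.congr_fun (HasFDerivAt.comp x (g := f) hf.hasFDerivAt h1).fderiv w

/-- The first variational equation. -/
theorem hasDerivAt_fderiv_flow (hΩ : IsOpen Ω) (hv : ContDiffOn ℝ ∞ v Ω) (hU : IsOpen U)
    (hα : ContDiffOn ℝ ∞ α (Ioo (-δ) δ ×ˢ U))
    (hαv : ∀ t ∈ Ioo (-δ) δ, ∀ x ∈ U,
      α (t, x) ∈ Ω ∧ HasDerivAt (fun s => α (s, x)) (v (α (t, x))) t)
    {t : ℝ} (ht : t ∈ Ioo (-δ) δ) {x : E} (hx : x ∈ U) (w : E) :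
    HasDerivAt (fun s => fderiv ℝ (fun y => α (s, y)) x w)
      (fderiv ℝ v (α (t, x)) (fderiv ℝ (fun y => α (t, y)) x w)) t := by
  have hopen : IsOpen (Ioo (-δ) δ ×ˢ U) := isOpen_Ioo.prod hU
  have hsm : ∀ s ∈ Ioo (-δ) δ, ∀ y ∈ U, ContDiffAt ℝ ∞ α (s, y) := fun s hs y hy =>
    hα.contDiffAt (hopen.mem_nhds ⟨hs, hy⟩)
  have hd : ∀ s ∈ Ioo (-δ) δ, ∀ y ∈ U, DifferentiableAt ℝ α (s, y) := fun s hs y hy =>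
    (hsm s hs y hy).differentiableAt (by simp)
  have h2 : HasFDerivAt (fderiv ℝ α) (fderiv ℝ (fderiv ℝ α) (t, x)) (t, x) :=
    ((hsm t ht x hx).fderiv_right (m := 1)
      (by rw [one_add_one_eq_two]; exact WithTop.coe_le_coe.mpr le_top)).differentiableAt
      one_ne_zero |>.hasFDerivAt
  -- Symmetry of the second derivative exchanges the time and space derivatives of `α`.
  have hsymm := (hsm t ht x hx).isSymmSndFDerivAt
    (by
      rw [minSmoothness_of_isRCLikeNormedField]
      exact WithTop.coe_le_coe.mpr le_top) (1, 0) (0, w)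
  -- differentiate in time
  have h3 : HasDerivAt (fun s => fderiv ℝ α (s, x) (0, w))
      (fderiv ℝ (fderiv ℝ α) (t, x) (1, 0) (0, w)) t := by
    have h4 : HasDerivAt (fun s : ℝ => ((s, x) : ℝ × E)) (1, 0) t :=
      (hasDerivAt_id t).prodMk (hasDerivAt_const t x)
    have h5 := HasFDerivAt.comp_hasDerivAt t h2 h4
    exact h5.clm_apply (hasDerivAt_const t ((0, w) : ℝ × E)) |>.congr_deriv (by simp)
  -- differentiate in space
  have h6 : fderiv ℝ (fderiv ℝ α) (t, x) (0, w) (1, 0) =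
      fderiv ℝ v (α (t, x)) (fderiv ℝ (fun y => α (t, y)) x w) := by
    have h7 : HasFDerivAt (fun y => fderiv ℝ α (t, y) (1, 0))
        (((ContinuousLinearMap.apply ℝ E ((1, 0) : ℝ × E)).comp
          (fderiv ℝ (fderiv ℝ α) (t, x))).comp (ContinuousLinearMap.inr ℝ ℝ E)) x :=
      HasFDerivAt.comp x (g := fun q => fderiv ℝ α q (1, 0))
        (HasFDerivAt.comp (t, x) (g := fun L : ℝ × E →L[ℝ] E => L (1, 0))
          (ContinuousLinearMap.apply ℝ E ((1, 0) : ℝ × E)).hasFDerivAt h2)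
        (hasFDerivAt_prodMk_right t x)
    have h8 : (fun y => fderiv ℝ α (t, y) (1, 0)) =ᶠ[𝓝 x] fun y => v (α (t, y)) := by
      filter_upwards [hU.mem_nhds hx] with y hy
      have h9 : HasDerivAt (fun s : ℝ => ((s, y) : ℝ × E)) (1, 0) t :=
        (hasDerivAt_id t).prodMk (hasDerivAt_const t y)
      exact (HasFDerivAt.comp_hasDerivAt t (hd t ht y hy).hasFDerivAt h9).unique (hαv t ht y hy).2
    have h10 : HasFDerivAt (fun y => v (α (t, y)))
        ((fderiv ℝ v (α (t, x))).comp (fderiv ℝ (fun y => α (t, y)) x)) x := by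
      refine HasFDerivAt.comp x (g := v) ?_ ?_
      · exact ((hv.contDiffAt (hΩ.mem_nhds (hαv t ht x hx).1)).differentiableAt
          (by simp)).hasFDerivAt
      · exact ((hd t ht x hx).comp x (f := fun y => (t, y)) (by fun_prop)).hasFDerivAt
    have h11 := (h7.congr_of_eventuallyEq h8.symm).unique h10
    exact DFunLike.congr_fun h11 w
  rw [← h6, ← hsymm]
  refine h3.congr_of_eventuallyEq ?_
  filter_upwards [Ioo_mem_nhds ht.1 ht.2] with s hs
  exact fderiv_partial_right (hd s hs x hx) w

/-- Pushforward of a vector field that is transported along a flow. -/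
theorem fderiv_flow_apply_of_transported (hΩ : IsOpen Ω) (hv : ContDiffOn ℝ ∞ v Ω)
    (hU : IsOpen U) (hα : ContDiffOn ℝ ∞ α (Ioo (-δ) δ ×ˢ U))
    (hα0 : ∀ x ∈ U, α (0, x) = x)
    (hαv : ∀ t ∈ Ioo (-δ) δ, ∀ x ∈ U,
      α (t, x) ∈ Ω ∧ HasDerivAt (fun s => α (s, x)) (v (α (t, x))) t)
    {ι : Type*} [Fintype ι] {k : ι → E → E} (hk : ∀ i, ContDiffOn ℝ ∞ (k i) Ω)
    {c c' : ℝ → ι → ℝ} (hc : ∀ t, HasDerivAt c (c' t) t)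
    (hcomm : ∀ t, ∀ y ∈ Ω, ∑ i, c' t i • k i y =
      -lieBracket ℝ v (fun z => ∑ i, c t i • k i z) y)
    {t : ℝ} (ht : t ∈ Ioo (-δ) δ) {x : E} (hx : x ∈ U) :
    fderiv ℝ (fun y => α (t, y)) x (∑ i, c 0 i • k i x) = ∑ i, c t i • k i (α (t, x)) := by
  have hδ : (0 : ℝ) ∈ Ioo (-δ) δ := ⟨by linarith [ht.1, ht.2], by linarith [ht.1, ht.2]⟩
  have hαx : ContinuousOn (fun s => α (s, x)) (Ioo (-δ) δ) := fun s hs =>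
    (hαv s hs x hx).2.continuousAt.continuousWithinAt
  -- Both sides solve `p' = Dv(α) p` with the same initial value. For the right side, the chain rule
  -- contributes `DW(v)` and `hcomm` contributes `-[v, W] = Dv(W) - DW(v)`.
  refine eqOn_Ioo_of_linear_ode (B := fun s => fderiv ℝ v (α (s, x)))
    (p := fun s => fderiv ℝ (fun y => α (s, y)) x (∑ i, c 0 i • k i x))
    (q := fun s => ∑ i, c s i • k i (α (s, x))) ?_
    (fun s hs => hasDerivAt_fderiv_flow hΩ hv hU hα hαv hs hx _) (fun s hs => ?_) ?_ ht
  · exact (hv.continuousOn_fderiv_of_isOpen hΩ (by simp)).comp hαx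
      (fun s hs => (hαv s hs x hx).1)
  · have hs' := hαv s hs x hx
    have hki : ∀ i, HasFDerivAt (k i) (fderiv ℝ (k i) (α (s, x))) (α (s, x)) := fun i =>
      (((hk i).contDiffAt (hΩ.mem_nhds hs'.1)).differentiableAt (by simp)).hasFDerivAt
    have h1 : HasDerivAt (fun r => ∑ i, c r i • k i (α (r, x)))
        (∑ i, (c s i • fderiv ℝ (k i) (α (s, x)) (v (α (s, x))) +
          c' s i • k i (α (s, x)))) s := by
      refine HasDerivAt.fun_sum fun i _ => ?_
      exact (hasDerivAt_pi.mp (hc s) i).smul ((hki i).comp_hasDerivAt s hs'.2)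
    refine h1.congr_deriv ?_
    have h2 : fderiv ℝ (fun z => ∑ i, c s i • k i z) (α (s, x)) =
        ∑ i, c s i • fderiv ℝ (k i) (α (s, x)) :=
      (HasFDerivAt.fun_sum fun i _ => (hki i).const_smul (c s i)).fderiv
    rw [Finset.sum_add_distrib, hcomm s _ hs'.1, lieBracket, h2]
    simp
  · have h1 : (fun y => α (0, y)) =ᶠ[𝓝 x] id := by
      filter_upwards [hU.mem_nhds hx] with y hy using hα0 y hy
    rw [h1.fderiv_eq, fderiv_id, hα0 x hx]
    rfl

/-- A vector field that is invariant under a local flow commutes with its generator. -/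
theorem lieBracket_eq_zero_of_fderiv_flow (hΩ : IsOpen Ω) (hv : ContDiffOn ℝ ∞ v Ω)
    (hU : IsOpen U) (hα : ContDiffOn ℝ ∞ α (Ioo (-δ) δ ×ˢ U)) (hδ : 0 < δ)
    (hα0 : ∀ x ∈ U, α (0, x) = x)
    (hαv : ∀ t ∈ Ioo (-δ) δ, ∀ x ∈ U,
      α (t, x) ∈ Ω ∧ HasDerivAt (fun s => α (s, x)) (v (α (t, x))) t)
    {w : E → E} {x : E} (hx : x ∈ U) (hw : DifferentiableAt ℝ w x)
    (hinv : ∀ᶠ t in 𝓝 (0 : ℝ), fderiv ℝ (fun y => α (t, y)) x (w x) = w (α (t, x))) :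
    lieBracket ℝ v w x = 0 := by
  have h0 : (0 : ℝ) ∈ Ioo (-δ) δ := ⟨by linarith, hδ⟩
  -- Differentiating the two sides of `hinv` at `t = 0` gives `Dv(w)` and `Dw(v)`, whose difference
  -- is the bracket.
  have h1 := hasDerivAt_fderiv_flow hΩ hv hU hα hαv h0 hx (w x)
  have h2 : HasDerivAt (fun t => w (α (t, x))) (fderiv ℝ w x (v x)) 0 := by
    have h3 := (hαv 0 h0 x hx).2
    rw [hα0 x hx] at h3
    refine HasFDerivAt.comp_hasDerivAt (l := w) (0 : ℝ) ?_ h3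
    rw [hα0 x hx]
    exact hw.hasFDerivAt
  have h4 := h1.unique (h2.congr_of_eventuallyEq hinv)
  have h5 : (fun y => α (0, y)) =ᶠ[𝓝 x] id := by
    filter_upwards [hU.mem_nhds hx] with y hy using hα0 y hy
  rw [h5.fderiv_eq, fderiv_id, hα0 x hx] at h4
  rw [lieBracket, ← h4]
  exact sub_self _

end LocalODE

set_option linter.unusedSectionVars false

/-! ### Vector fields in charts and curves of transported fields. -/

section Charts

variable {E : Type*} [NormedAddCommGroup E] [NormedSpace ℝ E] [FiniteDimensional ℝ E]
  {M : Type*} [TopologicalSpace M] [ChartedSpace E M] [IsManifold 𝓘(ℝ, E) ∞ M]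

/-- The local representative of a vector field in the chart at `y`. -/
def chartRep (y : M) (V : VField E M) : E → E :=
  mpullback 𝓘(ℝ, E) 𝓘(ℝ, E) (chartAt E y).symm (fun x => V x)

variable (E) in
theorem mdifferentiable_chartAt (y : M) :
    (chartAt E y).MDifferentiable 𝓘(ℝ, E) 𝓘(ℝ, E) :=
  have : IsManifold 𝓘(ℝ, E) 1 M := IsManifold.of_le (n := ∞) (by simp)
  mdifferentiable_chart y

theorem contMDiffAt_chartAt_symm {y : M} {z : E} (hz : z ∈ (chartAt E y).target) :
    ContMDiffAt 𝓘(ℝ, E) 𝓘(ℝ, E) ∞ (chartAt E y).symm z :=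
  (contMDiffOn_chart_symm z hz).contMDiffAt ((chartAt E y).open_target.mem_nhds hz)

theorem contMDiffAt_chartAt {y x : M} (hx : x ∈ (chartAt E y).source) :
    ContMDiffAt 𝓘(ℝ, E) 𝓘(ℝ, E) ∞ (chartAt E y) x :=
  (contMDiffOn_chart x hx).contMDiffAt ((chartAt E y).open_source.mem_nhds hx)

theorem isInvertible_mfderiv_chartAt_symm {y : M} {z : E} (hz : z ∈ (chartAt E y).target) :
    (mfderiv 𝓘(ℝ, E) 𝓘(ℝ, E) (chartAt E y).symm z).IsInvertible :=
  ⟨(mdifferentiable_chartAt E y).symm.mfderiv hz, rfl⟩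

theorem mfderiv_chartAt_symm_chartRep {y : M} {z : E} (hz : z ∈ (chartAt E y).target)
    (V : VField E M) :
    mfderiv 𝓘(ℝ, E) 𝓘(ℝ, E) (chartAt E y).symm z (chartRep (E := E) y V z) =
      V ((chartAt E y).symm z) :=
  (isInvertible_mfderiv_chartAt_symm hz).self_apply_inverse _

theorem mfderiv_chartAt_apply {y x : M} (hx : x ∈ (chartAt E y).source) (V : VField E M) :
    mfderiv 𝓘(ℝ, E) 𝓘(ℝ, E) (chartAt E y) x (V x) = chartRep y V (chartAt E y x) := by
  have hz := (chartAt E y).map_source hx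
  obtain ⟨L, hL⟩ := isInvertible_mfderiv_chartAt_symm hz
  have h1 := (mdifferentiable_chartAt E y).symm_comp_deriv hx
  have h2 : mfderiv 𝓘(ℝ, E) 𝓘(ℝ, E) (chartAt E y).symm (chartAt E y x)
      (mfderiv 𝓘(ℝ, E) 𝓘(ℝ, E) (chartAt E y) x (V x)) = V x := DFunLike.congr_fun h1 (V x)
  have h3 := mfderiv_chartAt_symm_chartRep hz V
  have h4 := (mdifferentiable_chartAt E y).symm.mfderiv_injective hz
  rw [(chartAt E y).left_inv hx] at h3
  exact h4 (h2.trans h3.symm)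

theorem contDiffOn_chartRep (y : M) (V : VField E M) :
    ContDiffOn ℝ ∞ (chartRep y V) (chartAt E y).target := by
  have := FiniteDimensional.complete ℝ E
  intro z hz
  refine ContDiffAt.contDiffWithinAt ?_
  exact contMDiffAt_vectorSpace_iff_contDiffAt.mp <| ContMDiffAt.mpullback_vectorField_preimage (n := ∞) (V.contMDiff _)
    (contMDiffAt_chartAt_symm hz) (isInvertible_mfderiv_chartAt_symm hz) (by simp)

theorem chartRep_sum (y : M) {ι : Type*} [Fintype ι] (c : ι → ℝ) (K : ι → VField E M) (z : E) :
    chartRep y (∑ i, c i • K i) z = ∑ i, c i • chartRep y (K i) z := by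
  let ev : VField E M →ₗ[ℝ] TangentSpace 𝓘(ℝ, E) ((chartAt E y).symm z) :=
    { toFun := fun V => V ((chartAt E y).symm z)
      map_add' := fun _ _ => rfl
      map_smul' := fun _ _ => rfl }
  let L : VField E M →ₗ[ℝ] E :=
    (mfderiv 𝓘(ℝ, E) 𝓘(ℝ, E) (chartAt E y).symm z).inverse.toLinearMap.comp ev
  have hL : ∀ V, L V = chartRep y V z := fun V => rfl
  rw [← hL, map_sum]
  simp_rw [map_smul, hL]

theorem lieBracket_chartRep {y : M} {z : E} (hz : z ∈ (chartAt E y).target)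
    (V W : VField E M) :
    lieBracket ℝ (chartRep y V) (chartRep y W) z = chartRep y ⁅V, W⁆ z := by
  have := FiniteDimensional.complete ℝ E
  have h2 : minSmoothness ℝ 2 ≤ (∞ : WithTop ℕ∞) := by
    rw [minSmoothness_of_isRCLikeNormedField]
    exact WithTop.coe_le_coe.mpr le_top
  have : IsManifold 𝓘(ℝ, E) (minSmoothness ℝ 2) M := IsManifold.of_le (n := ∞) h2
  have := mpullback_mlieBracket (n := ∞) (V.mdiff _) (W.mdiff _) (contMDiffAt_chartAt_symm hz) h2
  rw [← mlieBracketWithin_univ, ← mlieBracketWithin_univ, mlieBracketWithin_eq_lieBracketWithin,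
    mlieBracketWithin_univ] at this
  exact (this.trans (congrFun lieBracketWithin_univ z)).symm

theorem chartRep_neg (y : M) (V : VField E M) (z : E) :
    chartRep y (-V) z = -chartRep y V z := by
  have := chartRep_sum y (fun _ : Unit => (-1 : ℝ)) (fun _ => V) z
  simpa using this

/-- A local flow of `V`, defined on the open set `U` for times in `(-δ, δ)`. -/
structure IsLocalFlow (V : VField E M) (δ : ℝ) (U : Set M) (Fl : ℝ → M → M) : Prop where
  pos : 0 < δ
  isOpen : IsOpen U
  smooth : ContMDiffOn (𝓘(ℝ, ℝ).prod 𝓘(ℝ, E)) 𝓘(ℝ, E) ∞ (fun p : ℝ × M => Fl p.1 p.2)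
    (Ioo (-δ) δ ×ˢ U)
  zero : ∀ x ∈ U, Fl 0 x = x
  curve : ∀ x ∈ U, IsMIntegralCurveOn (I := 𝓘(ℝ, E)) (fun t => Fl t x) (fun z => V z)
    (Ioo (-δ) δ)

/-- A curve of vector fields with `W' = -[V, W]`: it is transported by the flow of `V`. -/
def IsTransported (V : VField E M) (W : ℝ → VField E M) : Prop :=
  ∃ (n : ℕ) (K : Fin n → VField E M) (c c' : ℝ → Fin n → ℝ), (∀ t, HasDerivAt c (c' t) t) ∧
    (∀ t, W t = ∑ i, c t i • K i) ∧ ∀ t, ∑ i, c' t i • K i = -⁅V, W t⁆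

/-- Used when flow maps are composed: the second flow map acts on the field already transported by
the first. -/
theorem IsTransported.comp_add {V : VField E M} {W : ℝ → VField E M} (h : IsTransported V W)
    (s : ℝ) : IsTransported V (fun t => W (s + t)) := by
  obtain ⟨n, K, c, c', hc, hW, hb⟩ := h
  exact ⟨n, K, fun t => c (s + t), fun t => c' (s + t),
    fun t => by simpa using (hc (s + t)).comp_const_add s t, fun t => hW _, fun t => hb _⟩

/-- Through this special case, commuting with a field becomes invariance under its flow. -/
theorem isTransported_const {V W : VField E M} (h : ⁅V, W⁆ = 0) :
    IsTransported V (fun _ => W) :=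
  ⟨1, fun _ => W, fun _ _ => 1, fun _ _ => 0, fun _ => hasDerivAt_const _ _, by simp,
    by simp [h]⟩

end Charts

/-! ### Local flows on the manifold, also with parameters. -/

section LocalFlows

variable {E : Type*} [NormedAddCommGroup E] [NormedSpace ℝ E] [FiniteDimensional ℝ E]
  {M : Type*} [TopologicalSpace M] [ChartedSpace E M] [IsManifold 𝓘(ℝ, E) ∞ M]

theorem hasMFDerivAt_chartAt_symm_comp {y : M} {V : VField E M} {β : ℝ → E} {t : ℝ}
    (hβ : β t ∈ (chartAt E y).target) (h : HasDerivAt β (chartRep y V (β t)) t) :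
    HasMFDerivAt 𝓘(ℝ, ℝ) 𝓘(ℝ, E) (fun s => (chartAt E y).symm (β s)) t
      ((1 : ℝ →L[ℝ] ℝ).smulRight (V ((chartAt E y).symm (β t)))) := by
  have h1 := (contMDiffAt_chartAt_symm hβ).mdifferentiableAt (by simp) |>.hasMFDerivAt
  have h2 := h.hasFDerivAt.hasMFDerivAt
  refine (HasMFDerivAt.comp t h1 h2).congr_mfderiv ?_
  refine ContinuousLinearMap.ext fun (r : ℝ) => ?_
  have h3 := mfderiv_chartAt_symm_chartRep hβ V
  refine Eq.trans ?_ (congrArg (fun w => r • w) h3)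
  exact (mfderiv 𝓘(ℝ, E) 𝓘(ℝ, E) (chartAt E y).symm (β t)).map_smul r
    (chartRep (E := E) y V (β t))

/-- Existence of local flows; they push transported fields forward, and a field that is invariant
under a local flow commutes with its generator. -/
theorem exists_isLocalFlow (V : VField E M) (y : M) :
    ∃ (δ : ℝ) (U : Set M) (Fl : ℝ → M → M), y ∈ U ∧ IsLocalFlow V δ U Fl ∧
      (∀ W : ℝ → VField E M, IsTransported V W → ∀ t ∈ Ioo (-δ) δ, ∀ x ∈ U,
        mfderiv 𝓘(ℝ, E) 𝓘(ℝ, E) (Fl t) x (W 0 x) = W t (Fl t x)) ∧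
      ∀ W : VField E M, ∀ x ∈ U, (∀ᶠ t in 𝓝 (0 : ℝ),
        mfderiv 𝓘(ℝ, E) 𝓘(ℝ, E) (Fl t) x (W x) = W (Fl t x)) → ⁅V, W⁆ x = 0 := by
  set χ := chartAt E y with hχ
  have hyχ : y ∈ χ.source := mem_chart_source E y
  obtain ⟨α, δ, hδ, hα, hα0, hαv⟩ := exists_contDiffOn_flow χ.open_target
    (contDiffOn_chartRep y V) (χ.map_source hyχ)
  set B := Metric.ball (χ y) δ
  let U : Set M := χ.source ∩ χ ⁻¹' B
  let Fl : ℝ → M → M := fun t x => χ.symm (α (t, χ x))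
  have hU : IsOpen U := χ.isOpen_inter_preimage Metric.isOpen_ball
  have hFls : ∀ t ∈ Ioo (-δ) δ, ∀ x ∈ U, Fl t x ∈ χ.source := fun t ht x hx =>
    χ.map_target (hαv t ht _ hx.2).1
  have hχFl : ∀ t ∈ Ioo (-δ) δ, ∀ x ∈ U, χ (Fl t x) = α (t, χ x) := fun t ht x hx =>
    χ.right_inv (hαv t ht _ hx.2).1
  -- the derivative of the flow in the chart
  have hder : ∀ (W : VField E M), ∀ t ∈ Ioo (-δ) δ, ∀ x ∈ U,
      mfderiv 𝓘(ℝ, E) 𝓘(ℝ, E) (Fl t) x (W x) =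
        mfderiv 𝓘(ℝ, E) 𝓘(ℝ, E) χ.symm (α (t, χ x))
          (fderiv ℝ (fun z => α (t, z)) (χ x) (chartRep (E := E) y W (χ x))) := by
    intro W t ht x hx
    have h1 := ((contMDiffAt_chartAt hx.1).mdifferentiableAt (by simp)).hasMFDerivAt
    have h2 : HasFDerivAt (fun z => α (t, z)) (fderiv ℝ (fun z => α (t, z)) (χ x)) (χ x) := by
      have h3 : DifferentiableAt ℝ α (t, χ x) :=
        (hα.contDiffAt ((isOpen_Ioo.prod Metric.isOpen_ball).mem_nhds
          (show (t, χ x) ∈ Ioo (-δ) δ ×ˢ B from ⟨ht, hx.2⟩))).differentiableAt (by simp)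
      exact (h3.comp (χ x) (f := fun z => (t, z)) (by fun_prop)).hasFDerivAt
    have h4 := ((contMDiffAt_chartAt_symm (hαv t ht _ hx.2).1).mdifferentiableAt
      (by simp)).hasMFDerivAt
    have h5 := HasMFDerivAt.comp x h4 (HasMFDerivAt.comp x h2.hasMFDerivAt h1)
    rw [← mfderiv_chartAt_apply hx.1 W]
    exact DFunLike.congr_fun h5.mfderiv (W x)
  refine ⟨δ, U, Fl, ⟨hyχ, Metric.mem_ball_self hδ⟩, ⟨hδ, hU, ?_, ?_, ?_⟩, ?_, ?_⟩
  · have h1 : ContMDiffOn (𝓘(ℝ, ℝ).prod 𝓘(ℝ, E)) 𝓘(ℝ, ℝ × E) ∞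
        (fun p : ℝ × M => (p.1, χ p.2)) (Ioo (-δ) δ ×ˢ U) :=
      contMDiffOn_fst.prodMk_space
        (contMDiffOn_chart.comp contMDiffOn_snd (fun p hp => hp.2.1))
    have h2 := hα.contMDiffOn.comp h1 (fun p hp => ⟨hp.1, hp.2.2⟩)
    exact contMDiffOn_chart_symm.comp h2 (fun p hp => (hαv _ hp.1 _ hp.2.2).1)
  · intro x hx
    change χ.symm (α (0, χ x)) = x
    rw [hα0 _ hx.2, χ.left_inv hx.1]
  · intro x hx t ht
    exact (hasMFDerivAt_chartAt_symm_comp (hαv t ht _ hx.2).1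
      (hαv t ht _ hx.2).2).hasMFDerivWithinAt
  · rintro W ⟨n, K, c, c', hc, hW, hb⟩ t ht x hx
    rw [hder _ t ht x hx]
    have h1 := fderiv_flow_apply_of_transported χ.open_target (contDiffOn_chartRep y V)
      Metric.isOpen_ball hα hα0 hαv (fun i => contDiffOn_chartRep y (K i)) hc (fun s z hz => by
        rw [← chartRep_sum, hb, chartRep_neg, ← lieBracket_chartRep hz, hW]
        simp_rw [← chartRep_sum]) ht hx.2
    have h2 : chartRep y (W 0) (χ x) = ∑ i, c 0 i • chartRep y (K i) (χ x) := by
      rw [hW, chartRep_sum]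
    rw [h2, h1, ← chartRep_sum, ← hW]
    exact mfderiv_chartAt_symm_chartRep (hαv t ht _ hx.2).1 (W t)
  · intro W x hx hinv
    have h1 : ∀ᶠ t in 𝓝 (0 : ℝ), fderiv ℝ (fun z => α (t, z)) (χ x) (chartRep y W (χ x)) =
        chartRep y W (α (t, χ x)) := by
      filter_upwards [hinv, Ioo_mem_nhds (neg_lt_zero.mpr hδ) hδ] with t h2 ht
      have hz := (hαv t ht _ hx.2).1
      rw [hder _ t ht x hx] at h2
      exact (isInvertible_mfderiv_chartAt_symm hz).injective
        (h2.trans (mfderiv_chartAt_symm_chartRep hz W).symm)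
    have h2 := lieBracket_eq_zero_of_fderiv_flow χ.open_target (contDiffOn_chartRep y V)
      Metric.isOpen_ball hα hδ hα0 hαv hx.2 (((contDiffOn_chartRep y W).contDiffAt
        (χ.open_target.mem_nhds (χ.map_source hx.1))).differentiableAt (by simp)) h1
    rw [lieBracket_chartRep (χ.map_source hx.1)] at h2
    have h3 := mfderiv_chartAt_symm_chartRep (χ.map_source hx.1) ⁅V, W⁆
    rw [χ.left_inv hx.1, h2] at h3
    exact h3.symm.trans (map_zero _)

/-- Local flows of a finite-dimensional family of vector fields depend smoothly on the
parameter. -/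
theorem exists_parametrized_flow {P : Type*} [NormedAddCommGroup P] [NormedSpace ℝ P]
    [FiniteDimensional ℝ P] (Z : P →ₗ[ℝ] VField E M) (p₀ : P) (y : M) :
    ∃ (δ : ℝ) (W : Set P) (U : Set M) (Fl : ℝ → P → M → M), 0 < δ ∧ IsOpen W ∧ p₀ ∈ W ∧
      IsOpen U ∧ y ∈ U ∧
      ContMDiffOn ((𝓘(ℝ, ℝ).prod 𝓘(ℝ, P)).prod 𝓘(ℝ, E)) 𝓘(ℝ, E) ∞
        (fun q : (ℝ × P) × M => Fl q.1.1 q.1.2 q.2) ((Ioo (-δ) δ ×ˢ W) ×ˢ U) ∧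
      (∀ p ∈ W, ∀ x ∈ U, Fl 0 p x = x) ∧
      ∀ p ∈ W, ∀ x ∈ U, IsMIntegralCurveOn (I := 𝓘(ℝ, E)) (fun t => Fl t p x)
        (fun z => Z p z) (Ioo (-δ) δ) := by
  set χ := chartAt E y with hχ
  have hyχ : y ∈ χ.source := mem_chart_source E y
  let b := Module.finBasis ℝ P
  have hZ : ∀ p z, chartRep y (Z p) z = ∑ i, b.repr p i • chartRep y (Z (b i)) z := by
    intro p z
    rw [← chartRep_sum]
    congr 1
    conv_lhs => rw [← b.sum_repr p, map_sum]
    simp_rw [map_smul]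
  -- The parameter becomes an extra coordinate with zero velocity, so smooth dependence on it is
  -- smooth dependence on the initial value.
  let v : P × E → P × E := fun q => (0, chartRep y (Z q.1) q.2)
  have hΩ : IsOpen ((univ : Set P) ×ˢ χ.target) := isOpen_univ.prod χ.open_target
  have hv : ContDiffOn ℝ ∞ v ((univ : Set P) ×ˢ χ.target) := by
    refine contDiffOn_const.prodMk ?_
    refine ContDiffOn.congr (f := fun q : P × E => ∑ i, b.repr q.1 i • chartRep y (Z (b i)) q.2)
      ?_ fun q _ => hZ q.1 q.2
    refine ContDiffOn.sum fun i _ => ContDiffOn.smul ?_ ?_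
    · exact ((LinearMap.toContinuousLinearMap (b.coord i)).contDiff.comp contDiff_fst).contDiffOn
    · exact (contDiffOn_chartRep y (Z (b i))).comp contDiffOn_snd (fun q hq => hq.2)
  obtain ⟨α, δ, hδ, hα, hα0, hαv⟩ := exists_contDiffOn_flow hΩ hv
    (x₀ := (p₀, χ y)) ⟨mem_univ _, χ.map_source hyχ⟩
  rw [← ball_prod_same] at hα hα0 hαv
  have hfst : ∀ t ∈ Ioo (-δ) δ, ∀ q ∈ Metric.ball p₀ δ ×ˢ Metric.ball (χ y) δ,
      (α (t, q)).1 = q.1 := by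
    intro t ht q hq
    refine eqOn_Ioo_of_linear_ode (B := fun _ => 0) (p := fun s => (α (s, q)).1)
      (q := fun _ => q.1) continuousOn_const (fun s hs => ?_) (fun s hs => ?_) ?_ ht
    · exact (hasFDerivAt_fst.comp_hasDerivAt s (hαv s hs q hq).2).congr_deriv rfl
    · exact (hasDerivAt_const s q.1).congr_deriv (by simp)
    · simp only [hα0 q hq]
  let U : Set M := χ.source ∩ χ ⁻¹' Metric.ball (χ y) δ
  refine ⟨δ, Metric.ball p₀ δ, U, fun t p x => χ.symm (α (t, (p, χ x))).2, hδ,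
    Metric.isOpen_ball, Metric.mem_ball_self hδ, χ.isOpen_inter_preimage Metric.isOpen_ball,
    ⟨hyχ, Metric.mem_ball_self hδ⟩, ?_, ?_, ?_⟩
  · have h1 : ContMDiffOn ((𝓘(ℝ, ℝ).prod 𝓘(ℝ, P)).prod 𝓘(ℝ, E)) 𝓘(ℝ, ℝ × P × E) ∞
        (fun q : (ℝ × P) × M => (q.1.1, (q.1.2, χ q.2)))
        ((Ioo (-δ) δ ×ˢ Metric.ball p₀ δ) ×ˢ U) :=
      (contMDiff_fst.comp contMDiff_fst).contMDiffOn.prodMk_space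
        ((contMDiff_snd.comp contMDiff_fst).contMDiffOn.prodMk_space
          (contMDiffOn_chart.comp contMDiffOn_snd (fun p hp => hp.2.1)))
    have h2 := (contDiff_snd.comp_contDiffOn hα).contMDiffOn.comp h1
      (fun p hp => ⟨hp.1.1, hp.1.2, hp.2.2⟩)
    exact contMDiffOn_chart_symm.comp h2
      (fun p hp => (hαv _ hp.1.1 _ (show (p.1.2, χ p.2) ∈ Metric.ball p₀ δ ×ˢ Metric.ball (χ y) δ
        from ⟨hp.1.2, hp.2.2⟩)).1.2)
  · intro p hp x hx
    change χ.symm (α (0, (p, χ x))).2 = x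
    rw [hα0 _ (show (p, χ x) ∈ Metric.ball p₀ δ ×ˢ Metric.ball (χ y) δ from ⟨hp, hx.2⟩),
      χ.left_inv hx.1]
  · intro p hp x hx t ht
    have hq : (p, χ x) ∈ Metric.ball p₀ δ ×ˢ Metric.ball (χ y) δ := ⟨hp, hx.2⟩
    have h1 := hαv t ht (p, χ x) hq
    refine (hasMFDerivAt_chartAt_symm_comp h1.1.2 ?_).hasMFDerivWithinAt
    refine (hasFDerivAt_snd.comp_hasDerivAt t h1.2).congr_deriv ?_
    change chartRep y (Z (α (t, (p, χ x))).1) _ = _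
    rw [hfst t ht (p, χ x) hq]

end LocalFlows

/-! ### Integral curves, the flow relation and flow maps near a trajectory. -/

section Flows

variable {E : Type*} [NormedAddCommGroup E] [NormedSpace ℝ E] [FiniteDimensional ℝ E]
  {M : Type*} [TopologicalSpace M] [ChartedSpace E M] [IsManifold 𝓘(ℝ, E) ∞ M]

theorem VField.contMDiff_one (V : VField E M) :
    ContMDiff 𝓘(ℝ, E) (𝓘(ℝ, E).tangent) 1 (fun x => (⟨x, V x⟩ : TangentBundle 𝓘(ℝ, E) M)) :=
  V.contMDiff.of_le (by simp)

/-- An integral curve on a compact interval extends to an open interval. -/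
theorem exists_isMIntegralCurveOn_Ioo {V : VField E M} {c : ℝ → M} {a b : ℝ} (hab : a ≤ b)
    (hc : IsMIntegralCurveOn (I := 𝓘(ℝ, E)) c (fun z => V z) (Icc a b)) :
    ∃ (c' : ℝ → M) (ε : ℝ), 0 < ε ∧ EqOn c' c (Icc a b) ∧
      IsMIntegralCurveOn (I := 𝓘(ℝ, E)) c' (fun z => V z) (Ioo (a - ε) (b + ε)) := by
  have := FiniteDimensional.complete ℝ E
  have : IsManifold 𝓘(ℝ, E) 1 M := IsManifold.of_le (n := ∞) (by simp)
  -- Short integral curves through the two end points are glued on. At each time the derivative is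
  -- checked separately from the left and from the right.
  obtain ⟨f, hfa, hf⟩ := exists_isMIntegralCurveAt_of_contMDiffAt_boundaryless a
    (V.contMDiff_one (c a))
  obtain ⟨g, hgb, hg⟩ := exists_isMIntegralCurveAt_of_contMDiffAt_boundaryless b
    (V.contMDiff_one (c b))
  obtain ⟨ε₁, hε₁, hf⟩ := Metric.eventually_nhds_iff_ball.mp hf
  obtain ⟨ε₂, hε₂, hg⟩ := Metric.eventually_nhds_iff_ball.mp hg
  classical
  let c' : ℝ → M := fun t => if t < a then f t else if t ≤ b then c t else g t
  have hc'f : ∀ t ≤ a, c' t = f t := by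
    intro t ht
    rcases ht.lt_or_eq with h | rfl
    · simp [c', h]
    · simp [c', hab, hfa]
  have hc'c : ∀ t ∈ Icc a b, c' t = c t := by
    intro t ht
    simp [c', not_lt.mpr ht.1, ht.2]
  have hc'g : ∀ t, b ≤ t → c' t = g t := by
    intro t ht
    rcases ht.lt_or_eq with h | rfl
    · simp [c', not_lt.mpr (hab.trans ht), not_le.mpr h]
    · rw [hc'c b ⟨hab, le_rfl⟩, hgb]
  refine ⟨c', min ε₁ ε₂, lt_min hε₁ hε₂, hc'c, fun t ht => ?_⟩
  have hfD : t ≤ a → HasMFDerivAt 𝓘(ℝ, ℝ) 𝓘(ℝ, E) f t ((1 : ℝ →L[ℝ] ℝ).smulRight (V (c' t))) := by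
    intro h
    rw [hc'f t h]
    refine hf t ?_
    rw [Real.ball_eq_Ioo]
    exact ⟨by linarith [ht.1, min_le_left ε₁ ε₂], by linarith⟩
  have hgD : b ≤ t → HasMFDerivAt 𝓘(ℝ, ℝ) 𝓘(ℝ, E) g t ((1 : ℝ →L[ℝ] ℝ).smulRight (V (c' t))) := by
    intro h
    rw [hc'g t h]
    refine hg t ?_
    rw [Real.ball_eq_Ioo]
    exact ⟨by linarith, by linarith [ht.2, min_le_right ε₁ ε₂]⟩
  have hcD : t ∈ Icc a b → HasMFDerivWithinAt 𝓘(ℝ, ℝ) 𝓘(ℝ, E) c' (Icc a b) t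
      ((1 : ℝ →L[ℝ] ℝ).smulRight (V (c' t))) := by
    intro h
    rw [hc'c t h]
    exact (hc t h).congr_mono hc'c (hc'c t h) le_rfl
  have hleft : HasMFDerivWithinAt 𝓘(ℝ, ℝ) 𝓘(ℝ, E) c' (Iic t) t
      ((1 : ℝ →L[ℝ] ℝ).smulRight (V (c' t))) := by
    rcases le_or_gt t a with h | h
    · exact (hfD h).hasMFDerivWithinAt.congr_mono (fun s hs => hc'f s (le_trans hs h))
        (hc'f t h) (subset_univ _)
    rcases le_or_gt t b with h' | h'
    · refine (hcD ⟨h.le, h'⟩).mono_of_mem_nhdsWithin ?_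
      filter_upwards [self_mem_nhdsWithin, mem_nhdsWithin_of_mem_nhds (Ioi_mem_nhds h)] with s h1 h2
      exact ⟨(mem_Ioi.mp h2).le, le_trans h1 h'⟩
    · refine (hgD h'.le).hasMFDerivWithinAt.congr_of_eventuallyEq ?_ (hc'g t h'.le)
      filter_upwards [mem_nhdsWithin_of_mem_nhds (Ioi_mem_nhds h')] with s h1
      exact hc'g s (le_of_lt h1)
  have hright : HasMFDerivWithinAt 𝓘(ℝ, ℝ) 𝓘(ℝ, E) c' (Ici t) t
      ((1 : ℝ →L[ℝ] ℝ).smulRight (V (c' t))) := by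
    rcases le_or_gt b t with h | h
    · exact (hgD h).hasMFDerivWithinAt.congr_mono (fun s hs => hc'g s (le_trans h hs))
        (hc'g t h) (subset_univ _)
    rcases le_or_gt a t with h' | h'
    · refine (hcD ⟨h', h.le⟩).mono_of_mem_nhdsWithin ?_
      filter_upwards [self_mem_nhdsWithin, mem_nhdsWithin_of_mem_nhds (Iio_mem_nhds h)] with s h1 h2
      exact ⟨le_trans h' h1, (mem_Iio.mp h2).le⟩
    · refine (hfD h'.le).hasMFDerivWithinAt.congr_of_eventuallyEq ?_ (hc'f t h'.le)
      filter_upwards [mem_nhdsWithin_of_mem_nhds (Iio_mem_nhds h')] with s h1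
      exact hc'f s (le_of_lt h1)
  have := hleft.union hright
  rw [Iic_union_Ici] at this
  exact this.mono (subset_univ _)

theorem FlowsTo.of_isMIntegralCurveOn {V : VField E M} {c : ℝ → M} {S : Set ℝ} {s t : ℝ}
    (hc : IsMIntegralCurveOn (I := 𝓘(ℝ, E)) c (fun z => V z) S) (h : uIcc s t ⊆ S) :
    FlowsTo V (t - s) (c s) (c t) := by
  refine ⟨c ∘ (· + s), by simp, by simp, (hc.comp_add s).mono fun r hr => h ?_⟩
  have := mem_image_of_mem (· + s) hr
  rwa [image_add_const_uIcc, zero_add, sub_add_cancel] at this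

theorem FlowsTo.symm {V : VField E M} {t : ℝ} {x y : M} (h : FlowsTo V t x y) :
    FlowsTo V (-t) y x := by
  obtain ⟨c, rfl, rfl, hc⟩ := h
  have := FlowsTo.of_isMIntegralCurveOn (s := t) (t := 0) hc (by rw [uIcc_comm])
  simpa using this

theorem FlowsTo.refl (V : VField E M) (x : M) : FlowsTo V 0 x x := by
  have := FiniteDimensional.complete ℝ E
  have : IsManifold 𝓘(ℝ, E) 1 M := IsManifold.of_le (n := ∞) (by simp)
  obtain ⟨f, hfa, hf⟩ := exists_isMIntegralCurveAt_of_contMDiffAt_boundaryless 0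
    (V.contMDiff_one x)
  refine ⟨f, hfa, hfa, fun t ht => ?_⟩
  rw [uIcc_self, mem_singleton_iff] at ht
  rw [ht]
  exact hf.hasMFDerivAt.hasMFDerivWithinAt

variable [T2Space M]

theorem eqOn_of_isMIntegralCurveOn_Ioo {V : VField E M} {c c' : ℝ → M} {a b t₀ : ℝ}
    (ht₀ : t₀ ∈ Ioo a b)
    (hc : IsMIntegralCurveOn (I := 𝓘(ℝ, E)) c (fun z => V z) (Ioo a b))
    (hc' : IsMIntegralCurveOn (I := 𝓘(ℝ, E)) c' (fun z => V z) (Ioo a b))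
    (h : c t₀ = c' t₀) : EqOn c c' (Ioo a b) :=
  have : IsManifold 𝓘(ℝ, E) 1 M := IsManifold.of_le (n := ∞) (by simp)
  isMIntegralCurveOn_Ioo_eqOn_of_contMDiff_boundaryless ht₀ V.contMDiff_one hc hc' h

/-- Both curves extend past the end points to a common open interval, where uniqueness of integral
curves applies. -/
theorem eqOn_of_isMIntegralCurveOn_uIcc {V : VField E M} {c c' : ℝ → M} {t : ℝ}
    (hc : IsMIntegralCurveOn (I := 𝓘(ℝ, E)) c (fun z => V z) (uIcc 0 t))
    (hc' : IsMIntegralCurveOn (I := 𝓘(ℝ, E)) c' (fun z => V z) (uIcc 0 t))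
    (h : c 0 = c' 0) : EqOn c c' (uIcc 0 t) := by
  obtain ⟨d, ε, hε, hd, hdc⟩ := exists_isMIntegralCurveOn_Ioo inf_le_sup hc
  obtain ⟨d', ε', hε', hd', hdc'⟩ := exists_isMIntegralCurveOn_Ioo inf_le_sup hc'
  have h0 : (0 : ℝ) ∈ uIcc 0 t := left_mem_uIcc
  have hm : 0 < min ε ε' := lt_min hε hε'
  have hs : uIcc 0 t ⊆ Ioo (0 ⊓ t - min ε ε') (0 ⊔ t + min ε ε') := fun s hs =>
    ⟨by linarith [hs.1], by linarith [hs.2]⟩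
  have h1 := eqOn_of_isMIntegralCurveOn_Ioo (hs h0)
    (hdc.mono (Ioo_subset_Ioo (by linarith [min_le_left ε ε']) (by linarith [min_le_left ε ε'])))
    (hdc'.mono (Ioo_subset_Ioo (by linarith [min_le_right ε ε'])
      (by linarith [min_le_right ε ε']))) ((hd h0).trans (h.trans (hd' h0).symm))
  exact fun s hs' => (hd hs').symm.trans ((h1 (hs hs')).trans (hd' hs'))

theorem FlowsTo.unique {V : VField E M} {t : ℝ} {x y z : M} (h : FlowsTo V t x y)
    (h' : FlowsTo V t x z) : y = z := by
  obtain ⟨c, hc0, rfl, hc⟩ := h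
  obtain ⟨c', hc0', rfl, hc'⟩ := h'
  exact eqOn_of_isMIntegralCurveOn_uIcc hc hc' (hc0.trans hc0'.symm) right_mem_uIcc

theorem FlowsTo.trans {V : VField E M} {s t : ℝ} {x y z : M} (h : FlowsTo V s x y)
    (h' : FlowsTo V t y z) : FlowsTo V (s + t) x z := by
  have : IsManifold 𝓘(ℝ, E) 1 M := IsManifold.of_le (n := ∞) (by simp)
  obtain ⟨c, rfl, rfl, hc⟩ := h
  obtain ⟨c', hc0, rfl, hc'⟩ := h'
  obtain ⟨d, ε, hε, hd, hdc⟩ := exists_isMIntegralCurveOn_Ioo inf_le_sup hc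
  obtain ⟨d', ε', hε', hd', hdc'⟩ := exists_isMIntegralCurveOn_Ioo inf_le_sup hc'
  have h1 := hdc'.comp_add (-s)
  have hset : {r | r + -s ∈ Ioo (0 ⊓ t - ε') (0 ⊔ t + ε')} =
      Ioo (0 ⊓ t - ε' + s) (0 ⊔ t + ε' + s) := by
    ext r
    simp only [mem_ofPred_eq, mem_Ioo]
    constructor <;> rintro ⟨h1, h2⟩ <;> constructor <;> linarith
  rw [hset] at h1
  have hin : uIcc 0 s ⊆ Ioo (0 ⊓ s - ε) (0 ⊔ s + ε) := fun r hr =>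
    ⟨by linarith [hr.1], by linarith [hr.2]⟩
  have hin' : ∀ r, r - s ∈ uIcc 0 t → r ∈ Ioo (0 ⊓ t - ε' + s) (0 ⊔ t + ε' + s) := fun r hr =>
    ⟨by linarith [hr.1], by linarith [hr.2]⟩
  have hs : d s = (d' ∘ (· + -s)) s := by
    rw [hd right_mem_uIcc]
    simp only [Function.comp_apply, add_neg_cancel]
    rw [hd' left_mem_uIcc, hc0]
  have hs2 : s ∈ Ioo (0 ⊓ t - ε' + s) (0 ⊔ t + ε' + s) := hin' s (by simp)
  -- Since `s` and `t` may have opposite signs, the two arcs may overlap in more than a point. After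
  -- extension and a shift by `s` they live on open intervals, agree on the overlap and glue there.
  have h2 := isMIntegralCurveOn_piecewise V.contMDiff_one hdc h1 ⟨hin right_mem_uIcc, hs2⟩ hs
  have h3 := eqOn_piecewise_of_isMIntegralCurveOn_Ioo V.contMDiff_one hdc h1
    ⟨hin right_mem_uIcc, hs2⟩ hs
  refine ⟨_, ?_, ?_, h2.mono fun r hr => ?_⟩
  · rw [piecewise_eq_of_mem _ _ _ (hin left_mem_uIcc), hd left_mem_uIcc]
  · rw [h3 (hin' (s + t) (by simp))]
    simp only [Function.comp_apply, add_neg_cancel_comm]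
    exact hd' right_mem_uIcc
  · rcases uIcc_subset_uIcc_union_uIcc (b := s) hr with h | h
    · exact Or.inl (hin h)
    · refine Or.inr (hin' r ?_)
      have := mem_image_of_mem (fun x => x - s) h
      rwa [image_sub_const_uIcc, sub_self, add_sub_cancel_left] at this

/-- Flow maps exist and are smooth near any trajectory, and they push transported fields
forward. -/
theorem FlowsTo.exists_flowMap {V : VField E M} {t : ℝ} {x y : M} (h : FlowsTo V t x y) :
    ∃ (U : Set M) (f : M → M), IsOpen U ∧ x ∈ U ∧ ContMDiffOn 𝓘(ℝ, E) 𝓘(ℝ, E) ∞ f U ∧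
      (∀ z ∈ U, FlowsTo V t z (f z)) ∧
      ∀ W : ℝ → VField E M, IsTransported V W → ∀ z ∈ U,
        mfderiv 𝓘(ℝ, E) 𝓘(ℝ, E) f z (W 0 z) = W t (f z) := by
  obtain ⟨c, rfl, rfl, hc⟩ := h
  -- `R r s` provides a flow map from near `c r` over the time `s - r`. Local flows give `R` between
  -- nearby times in both directions and composition gives transitivity, so connectedness of the
  -- time interval yields `R 0 t`.
  let R : ℝ → ℝ → Prop := fun r s =>
    ∃ (U : Set M) (f : M → M), IsOpen U ∧ c r ∈ U ∧ ContMDiffOn 𝓘(ℝ, E) 𝓘(ℝ, E) ∞ f U ∧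
      (∀ z ∈ U, FlowsTo V (s - r) z (f z)) ∧
      ∀ W : ℝ → VField E M, IsTransported V W → ∀ z ∈ U,
        mfderiv 𝓘(ℝ, E) 𝓘(ℝ, E) f z (W 0 z) = W (s - r) (f z)
  suffices R 0 t by simpa only [R, sub_zero] using this
  have hconn : (uIcc 0 t).OrdConnected := ordConnected_uIcc
  refine (isPreconnected_uIcc (a := (0 : ℝ)) (b := t)).induction₂' R ?_ ?_ left_mem_uIcc
    right_mem_uIcc
  · intro r hr
    obtain ⟨δ, U, Fl, hU, hFl, hW, -⟩ := exists_isLocalFlow V (c r)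
    have hnear : ∀ᶠ s in 𝓝[uIcc 0 t] r, s ∈ uIcc 0 t ∧ c s ∈ U ∧ |s - r| < δ := by
      refine eventually_mem_nhdsWithin.and (((hc.continuousWithinAt hr).eventually
        (hFl.isOpen.mem_nhds hU)).and (eventually_nhdsWithin_of_eventually_nhds ?_))
      exact (continuousAt_id.sub continuousAt_const).abs.eventually
        (Iio_mem_nhds (by simpa using hFl.pos))
    have key : ∀ r' s', c r' ∈ U → |s' - r'| < δ → R r' s' := by
      intro r' s' h1 h2
      rw [abs_lt] at h2
      refine ⟨U, Fl (s' - r'), hFl.isOpen, h1, ?_, fun z hz => ?_, fun W hWt z hz =>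
        hW W hWt _ h2 z hz⟩
      · exact hFl.smooth.comp (contMDiffOn_const.prodMk contMDiffOn_id) (fun z hz => ⟨h2, hz⟩)
      · have := FlowsTo.of_isMIntegralCurveOn (s := 0) (t := s' - r') (hFl.curve z hz)
          (ordConnected_Ioo.uIcc_subset ⟨neg_lt_zero.mpr hFl.pos, hFl.pos⟩ h2)
        simpa [hFl.zero z hz] using this
    filter_upwards [hnear] with s hs
    exact ⟨key r s hU hs.2.2, key s r hs.2.1 (by rw [abs_sub_comm]; exact hs.2.2)⟩
  · rintro r s u hr hs hu ⟨U, f, hU, hrU, hf, hfF, hfW⟩ ⟨U', g, hU', hsU', hg, hgF, hgW⟩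
    have hrs : f (c r) = c s := (hfF _ hrU).unique
      (FlowsTo.of_isMIntegralCurveOn hc (hconn.uIcc_subset hr hs))
    refine ⟨U ∩ f ⁻¹' U', g ∘ f, hf.continuousOn.isOpen_inter_preimage hU hU',
      ⟨hrU, by rwa [mem_preimage, hrs]⟩, hg.comp (hf.mono inter_subset_left) (fun z hz => hz.2),
      fun z hz => ?_, fun W hW z hz => ?_⟩
    · have := (hfF z hz.1).trans (hgF _ hz.2)
      simpa using this
    · have h1 : MDifferentiableAt 𝓘(ℝ, E) 𝓘(ℝ, E) f z :=
        (hf.contMDiffAt (hU.mem_nhds hz.1)).mdifferentiableAt (by simp)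
      have h2 : MDifferentiableAt 𝓘(ℝ, E) 𝓘(ℝ, E) g (f z) :=
        (hg.contMDiffAt (hU'.mem_nhds hz.2)).mdifferentiableAt (by simp)
      rw [mfderiv_comp z h2 h1]
      have h3 := hgW _ (hW.comp_add (s - r)) (f z) hz.2
      simp only [add_zero] at h3
      rw [← hfW W hW z hz.1] at h3
      refine h3.trans ?_
      rw [sub_add_sub_cancel']
      rfl

/-- Uniqueness of trajectories forces `f` to agree locally with the smooth flow maps found above. -/
theorem contMDiffOn_of_flowsTo {V : VField E M} {t : ℝ} {U : Set M} {f : M → M} (hU : IsOpen U)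
    (h : ∀ x ∈ U, FlowsTo V t x (f x)) : ContMDiffOn 𝓘(ℝ, E) 𝓘(ℝ, E) ∞ f U := by
  intro x hx
  obtain ⟨U', g, hU', hxU', hg, hgF, -⟩ := (h x hx).exists_flowMap
  refine ContMDiffAt.contMDiffWithinAt
    ((hg.contMDiffAt (hU'.mem_nhds hxU')).congr_of_eventuallyEq ?_)
  filter_upwards [hU.mem_nhds hx, hU'.mem_nhds hxU'] with z h1 h2
  exact (h z h1).unique (hgF z h2)

theorem mfderiv_of_flowsTo {V : VField E M} {t : ℝ} {U : Set M} {f : M → M} (hU : IsOpen U)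
    (h : ∀ x ∈ U, FlowsTo V t x (f x)) {W : ℝ → VField E M} (hW : IsTransported V W)
    {x : M} (hx : x ∈ U) : mfderiv 𝓘(ℝ, E) 𝓘(ℝ, E) f x (W 0 x) = W t (f x) := by
  obtain ⟨U', g, hU', hxU', hg, hgF, hgW⟩ := (h x hx).exists_flowMap
  have h1 : f =ᶠ[𝓝 x] g := by
    filter_upwards [hU.mem_nhds hx, hU'.mem_nhds hxU'] with z h1 h2
    exact (h z h1).unique (hgF z h2)
  have h2 := hgW W hW x hxU'
  rw [h1.mfderiv_eq, h1.eq_of_nhds]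
  exact h2

/-- A time-`t` flow map on an open set is an open partial homeomorphism. -/
theorem exists_openPartialHomeomorph_of_flowsTo {V : VField E M} {t : ℝ} {U : Set M} {f : M → M}
    (hU : IsOpen U) (h : ∀ x ∈ U, FlowsTo V t x (f x)) :
    ∃ e : OpenPartialHomeomorph M M, e.source = U ∧ (e : M → M) = f := by
  have hinj : InjOn f U := fun x hx y hy hxy =>
    (h x hx).symm.unique (by rw [hxy]; exact (h y hy).symm)
  rcases isEmpty_or_nonempty M with hM | hM
  · refine ⟨OpenPartialHomeomorph.refl M, ?_, ?_⟩
    · exact Subsingleton.elim _ _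
    · exact Subsingleton.elim _ _
  refine ⟨OpenPartialHomeomorph.ofContinuousOpenRestrict (hinj.toPartialEquiv f U)
    (contMDiffOn_of_flowsTo hU h).continuousOn ?_ hU, rfl, rfl⟩
  rw [isOpenMap_iff_nhds_le]
  rintro ⟨x, hx⟩ S hS
  rw [mem_map, mem_nhds_subtype] at hS
  obtain ⟨T, hT, hTS⟩ := hS
  -- The flow map `g` for time `-t` is a continuous local right inverse of `f`, which makes `f`
  -- open.
  obtain ⟨U', g, hU', hxU', hg, hgF, -⟩ := (h x hx).symm.exists_flowMap
  change S ∈ 𝓝 (f x)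
  have hgx : g (f x) = x := (hgF _ hxU').unique (h x hx).symm
  have hcont : ContinuousAt g (f x) := (hg.contMDiffAt (hU'.mem_nhds hxU')).continuousAt
  have hTU : T ∩ U ∈ 𝓝 (g (f x)) := by
    rw [hgx]
    exact inter_mem hT (hU.mem_nhds hx)
  filter_upwards [hU'.mem_nhds hxU', hcont hTU]
    with y h1 ⟨h2, h3⟩
  have h4 : f (g y) = y := by
    have := (hgF y h1).symm
    rw [neg_neg] at this
    exact (h _ h3).unique this
  have h5 : (⟨g y, h3⟩ : U) ∈ Subtype.val ⁻¹' T := h2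
  have h6 := hTS h5
  change f (g y) ∈ S at h6
  rwa [h4] at h6

end Flows

/-! ### Flow maps that reach nearby points and depend smoothly on them. -/

section LocalSections

variable {E : Type*} [NormedAddCommGroup E] [NormedSpace ℝ E] [FiniteDimensional ℝ E]

/-- The inverse function theorem on a finite-dimensional space, with a smooth local right
inverse. -/
theorem exists_contDiffOn_rightInverse {f : E → E} {a : E} {W : Set E} (hW : IsOpen W)
    (ha : a ∈ W) (hf : ContDiffOn ℝ ∞ f W) (hinj : Function.Injective (fderiv ℝ f a)) :
    ∃ (Ω : Set E) (σ : E → E), IsOpen Ω ∧ f a ∈ Ω ∧ ContDiffOn ℝ ∞ σ Ω ∧ σ (f a) = a ∧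
      ∀ w ∈ Ω, σ w ∈ W ∧ f (σ w) = w := by
  have := FiniteDimensional.complete ℝ E
  let L : E ≃L[ℝ] E := (LinearEquiv.ofInjectiveEndo (fderiv ℝ f a).toLinearMap
    hinj).toContinuousLinearEquiv
  have hfa := hf.contDiffAt (hW.mem_nhds ha)
  have hB : HasFDerivAt f (L : E →L[ℝ] E) a := by
    convert! (hfa.differentiableAt (by simp)).hasFDerivAt
  let e := hfa.toOpenPartialHomeomorph f hB (by simp)
  have has : a ∈ e.source := ContDiffAt.mem_toOpenPartialHomeomorph_source _ hB _
  have hleft : e.symm (f a) = a := e.left_inv has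
  have hinv : ∀ᶠ q in 𝓝 (f a), q ∈ e.target ∧ e.symm q ∈ W ∧ ContDiffAt ℝ ∞ e.symm q := by
    have h1 : ∀ᶠ q in 𝓝 a, q ∈ W ∧ fderiv ℝ f q ∈ range ((↑) : (E ≃L[ℝ] E) → (E →L[ℝ] E)) := by
      have h3 : ContinuousAt (fderiv ℝ f) a :=
        (hf.continuousOn_fderiv_of_isOpen hW (by simp)).continuousAt (hW.mem_nhds ha)
      have h4 : range ((↑) : (E ≃L[ℝ] E) → (E →L[ℝ] E)) ∈ 𝓝 (fderiv ℝ f a) := by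
        rw [hB.fderiv]
        exact ContinuousLinearEquiv.nhds L
      filter_upwards [hW.mem_nhds ha, h3 h4] with q h5 h6
      exact ⟨h5, h6⟩
    have h2 : Tendsto e.symm (𝓝 (f a)) (𝓝 a) := e.tendsto_symm has
    filter_upwards [h2.eventually h1, e.open_target.mem_nhds (e.map_source has)]
      with q ⟨hqW, T, hT⟩ hqt
    have h3 := hf.contDiffAt (hW.mem_nhds hqW)
    refine ⟨hqt, hqW, e.contDiffAt_symm (f₀' := T) hqt ?_ h3⟩
    rw [hT]
    exact (h3.differentiableAt (by simp)).hasFDerivAt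
  obtain ⟨Ω, hΩs, hΩ, haΩ⟩ := mem_nhds_iff.mp hinv
  exact ⟨Ω, e.symm, hΩ, haΩ, fun w hw => (hΩs hw).2.2.contDiffWithinAt, hleft,
    fun w hw => ⟨(hΩs hw).2.1, e.right_inv (hΩs hw).1⟩⟩

variable {M : Type*} [TopologicalSpace M] [ChartedSpace E M] [IsManifold 𝓘(ℝ, E) ∞ M]

theorem hasDerivAt_chartAt_comp {y : M} {V : VField E M} {c : ℝ → M} {t : ℝ}
    (hct : c t ∈ (chartAt E y).source)
    (hc : HasMFDerivAt 𝓘(ℝ, ℝ) 𝓘(ℝ, E) c t ((1 : ℝ →L[ℝ] ℝ).smulRight (V (c t)))) :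
    HasDerivAt (fun s => chartAt E y (c s)) (chartRep y V (chartAt E y (c t))) t := by
  have h1 := ((contMDiffAt_chartAt hct).mdifferentiableAt (by simp)).hasMFDerivAt
  have h2 : HasMFDerivAt 𝓘(ℝ, ℝ) 𝓘(ℝ, E) (fun s => chartAt E y (c s)) t
      ((1 : ℝ →L[ℝ] ℝ).smulRight (chartRep (E := E) y V (chartAt E y (c t)))) := by
    refine (HasMFDerivAt.comp t h1 hc).congr_mfderiv ?_
    refine ContinuousLinearMap.ext fun (r : ℝ) => ?_
    refine Eq.trans ?_ (congrArg (fun w => r • w) (mfderiv_chartAt_apply hct V))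
    exact (mfderiv 𝓘(ℝ, E) 𝓘(ℝ, E) (chartAt E y) (c t)).map_smul r (V (c t))
  have h3 : HasFDerivAt (fun s => chartAt E y (c s))
      ((1 : ℝ →L[ℝ] ℝ).smulRight (chartRep (E := E) y V (chartAt E y (c t))) : ℝ →L[ℝ] E) t :=
    h2.hasFDerivAt
  exact h3.hasDerivAt.congr_deriv (by simp)

variable (E) in
/-- Evaluation of vector fields at a point. -/
def VField.eval (x : M) : VField E M →ₗ[ℝ] TangentSpace 𝓘(ℝ, E) x where
  toFun V := V x
  map_add' _ _ := rfl
  map_smul' _ _ := rfl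

variable [T2Space M] {𝔤 : Type*} [LieRing 𝔤] [LieAlgebra ℝ 𝔤]

/-- For a transitive action, nearby points are joined to a given point by time-`τ` flow maps that
depend smoothly on the point. -/
theorem IsTransitive.exists_localSection {ζ : 𝔤 →ₗ⁅ℝ⁆ VField E M} (hζ : IsTransitive ζ) (y : M) :
    ∃ (W U : Set M) (τ : ℝ) (X : M → 𝔤) (G : M → M → M), IsOpen W ∧ y ∈ W ∧ IsOpen U ∧ y ∈ U ∧
      ContMDiffOn (𝓘(ℝ, E).prod 𝓘(ℝ, E)) 𝓘(ℝ, E) ∞ (fun q : M × M => G q.1 q.2) (W ×ˢ U) ∧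
      (∀ z ∈ W, G z y = z) ∧ ∀ z ∈ W, ∀ x ∈ U, FlowsTo (ζ (X z)) τ x (G z x) := by
  -- A linear right inverse of evaluation at `y` gives a family of fundamental fields `Z u`, `u :
  -- E`, with `Z u` equal to `u` at `y`.
  obtain ⟨r, hr⟩ := LinearMap.exists_rightInverse_of_surjective
    ((VField.eval E y).comp ζ.toLinearMap) (LinearMap.range_eq_top.mpr (hζ y))
  have hr : ∀ u : E, ζ (r u) y = u := fun u => LinearMap.congr_fun hr u
  let Z : E →ₗ[ℝ] VField E M := ζ.toLinearMap.comp r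
  obtain ⟨δ, W₀, U, Fl, hδ, hW₀, h0W₀, hU, hyU, hFl, hFl0, hFlc⟩ :=
    exists_parametrized_flow Z 0 y
  set χ := chartAt E y with hχ
  have hyχ : y ∈ χ.source := mem_chart_source E y
  set τ : ℝ := δ / 2 with hτ
  have hτpos : 0 < τ := by positivity
  have hτδ : τ ∈ Ioo (-δ) δ := ⟨by linarith, by linarith⟩
  -- Flowing along `s • v` for time `τ` is flowing along `v` for time `τ * s`. The derivative at 0
  -- of `u ↦ Fl τ u y` can then be read off from the velocity of a trajectory.
  have hresc : ∀ v ∈ W₀, ∀ s : ℝ, |s| ≤ 1 → s • v ∈ W₀ → Fl τ (s • v) y = Fl (τ * s) v y := by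
    intro v hv s hs hsv
    have h1 := (hFlc v hv y hyU).comp_mul s
    have h2 : IsMIntegralCurveOn (I := 𝓘(ℝ, E)) ((fun t => Fl t v y) ∘ (· * s))
        (fun z => Z (s • v) z) (Ioo (-δ) δ) := by
      rw [map_smul]
      refine h1.mono fun t ht => abs_lt.mp ?_
      rw [abs_mul]
      exact lt_of_le_of_lt (mul_le_of_le_one_right (abs_nonneg t) hs) (abs_lt.mpr ht)
    refine eqOn_of_isMIntegralCurveOn_Ioo (t₀ := 0) ⟨neg_lt_zero.mpr hδ, hδ⟩
      (hFlc _ hsv y hyU) h2 ?_ hτδ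
    simp only [Function.comp_apply, zero_mul]
    rw [hFl0 _ hsv y hyU, hFl0 _ hv y hyU]
  have hh0 : Fl τ 0 y = y := by
    have := hresc 0 h0W₀ 0 (by simp) (by simpa using h0W₀)
    rwa [smul_zero, mul_zero, hFl0 0 h0W₀ y hyU] at this
  have hhs : ContMDiffOn 𝓘(ℝ, E) 𝓘(ℝ, E) ∞ (fun u => Fl τ u y) W₀ :=
    hFl.comp ((contMDiffOn_const.prodMk contMDiffOn_id).prodMk contMDiffOn_const)
      (fun u hu => ⟨⟨hτδ, hu⟩, hyU⟩)
  let W₁ : Set E := W₀ ∩ (fun u => Fl τ u y) ⁻¹' χ.source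
  have hW₁ : IsOpen W₁ := hhs.continuousOn.isOpen_inter_preimage hW₀ χ.open_source
  have h0W₁ : (0 : E) ∈ W₁ := ⟨h0W₀, by rwa [mem_preimage, hh0]⟩
  let k : E → E := fun u => χ (Fl τ u y)
  have hk : ContDiffOn ℝ ∞ k W₁ :=
    contMDiffOn_iff_contDiffOn.mp
      ((contMDiffOn_chart (x := y)).comp (hhs.mono inter_subset_left) (fun u hu => hu.2))
  have hkder : ∀ v ∈ W₀, fderiv ℝ k 0 v = τ • mfderiv 𝓘(ℝ, E) 𝓘(ℝ, E) χ y v := by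
    intro v hv
    have h1 : HasDerivAt (fun s : ℝ => k (s • v)) (fderiv ℝ k 0 v) 0 := by
      have h2 : HasFDerivAt k (fderiv ℝ k 0) ((0 : ℝ) • v) := by
        rw [zero_smul]
        exact ((hk.contDiffAt (hW₁.mem_nhds h0W₁)).differentiableAt (by simp)).hasFDerivAt
      have h3 : HasDerivAt (fun s : ℝ => s • v) v 0 := by
        simpa using (hasDerivAt_id (0 : ℝ)).smul_const v
      exact h2.comp_hasDerivAt (0 : ℝ) h3
    have h2 : HasDerivAt (fun t : ℝ => χ (Fl t v y)) (mfderiv 𝓘(ℝ, E) 𝓘(ℝ, E) χ y v) 0 := by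
      have h00 : Fl 0 v y = y := hFl0 v hv y hyU
      have h3 := (hFlc v hv y hyU 0 ⟨neg_lt_zero.mpr hδ, hδ⟩).hasMFDerivAt
        (Ioo_mem_nhds (neg_lt_zero.mpr hδ) hδ)
      have hmem : Fl 0 v y ∈ χ.source := by rwa [h00]
      refine (hasDerivAt_chartAt_comp hmem h3).congr_deriv ?_
      rw [h00, ← mfderiv_chartAt_apply hyχ (Z v)]
      exact congrArg (mfderiv 𝓘(ℝ, E) 𝓘(ℝ, E) χ y) (hr v)
    have h3 : HasDerivAt (fun s : ℝ => χ (Fl (τ * s) v y))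
        (τ • mfderiv 𝓘(ℝ, E) 𝓘(ℝ, E) χ y v) 0 := by
      have h4 : HasDerivAt (fun s : ℝ => τ * s) τ 0 := by
        simpa using (hasDerivAt_id (0 : ℝ)).const_mul τ
      have h5 : HasDerivAt (fun t : ℝ => χ (Fl t v y)) (mfderiv 𝓘(ℝ, E) 𝓘(ℝ, E) χ y v)
          (τ * 0) := by rwa [mul_zero]
      exact h5.scomp (0 : ℝ) h4
    refine h1.unique (h3.congr_of_eventuallyEq ?_)
    have h4 : ∀ᶠ s : ℝ in 𝓝 0, s • v ∈ W₀ := by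
      have : ContinuousAt (fun s : ℝ => s • v) 0 := by fun_prop
      exact this (show W₀ ∈ 𝓝 ((0 : ℝ) • v) by rw [zero_smul]; exact hW₀.mem_nhds h0W₀)
    filter_upwards [h4, Metric.ball_mem_nhds (0 : ℝ) one_pos] with s hs1 hs2
    have : |s| ≤ 1 := by
      rw [mem_ball_zero_iff, Real.norm_eq_abs] at hs2
      exact hs2.le
    simp only [k, hresc v hv s this hs1]
  have hinj : Function.Injective (fderiv ℝ k 0) := by
    rw [injective_iff_map_eq_zero]
    intro v hv
    have h4 : ∀ᶠ s : ℝ in 𝓝[≠] 0, s • v ∈ W₀ := by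
      have : ContinuousAt (fun s : ℝ => s • v) 0 := by fun_prop
      exact eventually_nhdsWithin_of_eventually_nhds
        (this (show W₀ ∈ 𝓝 ((0 : ℝ) • v) by rw [zero_smul]; exact hW₀.mem_nhds h0W₀))
    -- The formula `hkder` holds only for `v` in `W₀`, so `v` is first scaled into `W₀` by a nonzero
    -- `s`.
    obtain ⟨s, hs, hs0⟩ := (h4.and eventually_mem_nhdsWithin).exists
    have h5 := hkder _ hs
    rw [map_smul, hv, smul_zero] at h5
    have h6 := (smul_eq_zero.mp h5.symm).resolve_left hτpos.ne'
    have h7 := (mdifferentiable_chartAt E y).mfderiv_injective hyχ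
      (h6.trans (map_zero (mfderiv 𝓘(ℝ, E) 𝓘(ℝ, E) χ y)).symm)
    exact (smul_eq_zero.mp h7).resolve_left hs0
  obtain ⟨Ω, σ, hΩ, hΩ0, hσ, hσ0, hσΩ⟩ := exists_contDiffOn_rightInverse hW₁ h0W₁ hk hinj
  have hk0 : k 0 = χ y := by simp only [k, hh0]
  refine ⟨χ.source ∩ χ ⁻¹' Ω, U, τ, fun z => r (σ (χ z)), fun z x => Fl τ (σ (χ z)) x,
    χ.isOpen_inter_preimage hΩ, ⟨hyχ, by rwa [mem_preimage, ← hk0]⟩, hU, hyU, ?_, ?_, ?_⟩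
  · have h1 : ContMDiffOn (𝓘(ℝ, E).prod 𝓘(ℝ, E)) 𝓘(ℝ, E) ∞ (fun q : M × M => σ (χ q.1))
        ((χ.source ∩ χ ⁻¹' Ω) ×ˢ U) :=
      hσ.contMDiffOn.comp ((contMDiffOn_chart (x := y)).comp contMDiffOn_fst
        (fun q hq => hq.1.1)) (fun q hq => hq.1.2)
    exact hFl.comp ((contMDiffOn_const.prodMk h1).prodMk contMDiffOn_snd)
      (fun q hq => ⟨⟨hτδ, (hσΩ _ hq.1.2).1.1⟩, hq.2⟩)
  · intro z hz
    obtain ⟨h1, h2⟩ := hσΩ _ hz.2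
    exact χ.injOn h1.2 hz.1 h2
  · intro z hz x hx
    have hu := (hσΩ _ hz.2).1.1
    have := FlowsTo.of_isMIntegralCurveOn (s := 0) (t := τ) (hFlc _ hu x hx)
      (ordConnected_Ioo.uIcc_subset ⟨neg_lt_zero.mpr hδ, hδ⟩ hτδ)
    rw [sub_zero] at this
    simp only [hFl0 _ hu x hx] at this
    exact this

end LocalSections

/-! ### Compositions of flows and their action on vector fields. -/

section Composites

variable {E : Type*} [NormedAddCommGroup E] [NormedSpace ℝ E] [FiniteDimensional ℝ E]
  {M : Type*} [TopologicalSpace M] [T2Space M] [ChartedSpace E M] [IsManifold 𝓘(ℝ, E) ∞ M]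
  {𝔤 : Type*} [LieRing 𝔤] [LieAlgebra ℝ 𝔤] {ζ : 𝔤 →ₗ⁅ℝ⁆ VField E M}

-- The identity is a flow at time 0, so compositions of flows may be restricted to smaller open
-- sets.
variable (ζ) in
theorem isFlowComposite_ofSet {s : Set M} (hs : IsOpen s) :
    IsFlowComposite ζ (OpenPartialHomeomorph.ofSet s hs) :=
  .flow 0 0 _ fun x _ => FlowsTo.refl _ x

theorem IsFlowComposite.symm {e : OpenPartialHomeomorph M M} (h : IsFlowComposite ζ e) :
    IsFlowComposite ζ e.symm := by
  induction h with
  | flow X t e h =>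
    refine .flow X (-t) _ fun y hy => ?_
    have := (h _ (e.map_target hy)).symm
    rwa [e.right_inv hy] at this
  | comp e e' _ _ ih ih' =>
    rw [OpenPartialHomeomorph.trans_symm_eq_symm_trans_symm]
    exact .comp _ _ ih' ih

theorem IsFlowComposite.contMDiffOn {e : OpenPartialHomeomorph M M} (h : IsFlowComposite ζ e) :
    ContMDiffOn 𝓘(ℝ, E) 𝓘(ℝ, E) ∞ e e.source := by
  induction h with
  | flow X t e h => exact contMDiffOn_of_flowsTo e.open_source h
  | comp e e' _ _ ih ih' =>
    rw [OpenPartialHomeomorph.coe_trans, OpenPartialHomeomorph.trans_source]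
    exact ih'.comp (ih.mono inter_subset_left) fun x hx => hx.2

theorem IsFlowComposite.contMDiffAt {e : OpenPartialHomeomorph M M} (h : IsFlowComposite ζ e)
    {x : M} (hx : x ∈ e.source) : ContMDiffAt 𝓘(ℝ, E) 𝓘(ℝ, E) ∞ e x :=
  h.contMDiffOn.contMDiffAt (e.open_source.mem_nhds hx)

theorem IsFlowComposite.mdifferentiableAt {e : OpenPartialHomeomorph M M}
    (h : IsFlowComposite ζ e) {x : M} (hx : x ∈ e.source) :
    MDifferentiableAt 𝓘(ℝ, E) 𝓘(ℝ, E) e x :=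
  (h.contMDiffAt hx).mdifferentiableAt (by simp)

theorem IsFlowComposite.mdifferentiable {e : OpenPartialHomeomorph M M}
    (h : IsFlowComposite ζ e) : e.MDifferentiable 𝓘(ℝ, E) 𝓘(ℝ, E) :=
  ⟨h.contMDiffOn.mdifferentiableOn (by simp), h.symm.contMDiffOn.mdifferentiableOn (by simp)⟩

theorem IsFlowComposite.mfderiv_trans {e e' : OpenPartialHomeomorph M M}
    (h : IsFlowComposite ζ e) (h' : IsFlowComposite ζ e') {x : M} (hx : x ∈ (e.trans e').source)
    (v : TangentSpace 𝓘(ℝ, E) x) : mfderiv 𝓘(ℝ, E) 𝓘(ℝ, E) (e.trans e') x v =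
      mfderiv 𝓘(ℝ, E) 𝓘(ℝ, E) e' (e x) (mfderiv 𝓘(ℝ, E) 𝓘(ℝ, E) e x v) := by
  rw [OpenPartialHomeomorph.trans_source] at hx
  exact DFunLike.congr_fun
    (mfderiv_comp x (h'.mdifferentiableAt hx.2) (h.mdifferentiableAt hx.1)) v

/-- Fields commuting with the action are invariant under compositions of flows. -/
theorem IsFlowComposite.mfderiv_of_mem_centralizer {e : OpenPartialHomeomorph M M}
    (h : IsFlowComposite ζ e) {η : VField E M} (hη : η ∈ centralizer ζ) {x : M}
    (hx : x ∈ e.source) : mfderiv 𝓘(ℝ, E) 𝓘(ℝ, E) e x (η x) = η (e x) := by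
  induction h generalizing x with
  | flow X t e h =>
    have h1 : ⁅ζ X, η⁆ = 0 := by rw [← lie_skew, hη X, neg_zero]
    exact mfderiv_of_flowsTo e.open_source h (isTransported_const h1) hx
  | comp e e' he he' ih ih' =>
    rw [he.mfderiv_trans he' hx]
    rw [OpenPartialHomeomorph.trans_source] at hx
    rw [ih hx.1, ih' hx.2]
    rfl

/-! ### The linear action of compositions of flows on the Lie algebra. -/

section Adjoint

variable [FiniteDimensional ℝ 𝔤]

/-- The curves `t ↦ exp (-t ad Y) X` in the Lie algebra are transported by the flow. -/
theorem exists_isTransported_linearEquiv (ζ : 𝔤 →ₗ⁅ℝ⁆ VField E M) (Y : 𝔤) :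
    ∃ A : ℝ → (𝔤 ≃ₗ[ℝ] 𝔤), (∀ X, A 0 X = X) ∧
      ∀ X, IsTransported (ζ Y) (fun t => ζ (A t X)) := by
  let b := Module.finBasis ℝ 𝔤
  let n := Module.finrank ℝ 𝔤
  -- This is `ad Y` in coordinates. Passing to `Fin n → ℝ` supplies the norm needed for the operator
  -- exponential, since `𝔤` carries none.
  let D : (Fin n → ℝ) →L[ℝ] (Fin n → ℝ) := LinearMap.toContinuousLinearMap
    (b.equivFun.toLinearMap ∘ₗ (LieAlgebra.ad ℝ 𝔤 Y : 𝔤 →ₗ[ℝ] 𝔤) ∘ₗ b.equivFun.symm.toLinearMap)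
  have hD : ∀ c, b.equivFun.symm (D c) = ⁅Y, b.equivFun.symm c⁆ := by
    intro c
    change b.equivFun.symm (b.equivFun ⁅Y, b.equivFun.symm c⁆) = _
    exact b.equivFun.symm_apply_apply _
  have hK : ∀ c : Fin n → ℝ, ζ (b.equivFun.symm c) = ∑ i, c i • ζ (b i) := by
    intro c
    rw [Module.Basis.equivFun_symm_apply, map_sum]
    exact Finset.sum_congr rfl fun i _ => map_smul ζ _ _
  let _ : NormedAlgebra ℚ ((Fin n → ℝ) →L[ℝ] (Fin n → ℝ)) := NormedAlgebra.restrictScalars ℚ ℝ _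
  have hu : ∀ t : ℝ, IsUnit (NormedSpace.exp (t • (-D))) := fun t => NormedSpace.isUnit_exp _
  let A : ℝ → (𝔤 ≃ₗ[ℝ] 𝔤) := fun t =>
    b.equivFun.trans ((ContinuousLinearEquiv.ofUnit (hu t).unit).toLinearEquiv.trans
      b.equivFun.symm)
  have hA : ∀ t X, A t X = b.equivFun.symm (NormedSpace.exp (t • (-D)) (b.equivFun X)) :=
    fun t X => rfl
  refine ⟨A, fun X => by simp [hA], fun X => ?_⟩
  refine ⟨n, fun i => ζ (b i), fun t => NormedSpace.exp (t • (-D)) (b.equivFun X),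
    fun t => (-D * NormedSpace.exp (t • (-D))) (b.equivFun X), fun t => ?_, fun t => ?_,
    fun t => ?_⟩
  · have h1 := hasDerivAt_exp_smul_const' (𝕂 := ℝ) (-D) t
    exact (ContinuousLinearMap.apply ℝ (Fin n → ℝ) (b.equivFun X)).hasFDerivAt.comp_hasDerivAt t h1
  · change ζ (A t X) = _
    rw [hA, hK]
  · change _ = -⁅ζ Y, ζ (A t X)⁆
    rw [← hK, hA]
    change ζ (b.equivFun.symm (-D (NormedSpace.exp (t • (-D)) (b.equivFun X)))) = _
    rw [map_neg, map_neg, hD, LieHom.map_lie]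

/-- A composition of flows acts on the fundamental fields by a linear automorphism of the Lie
algebra. -/
theorem IsFlowComposite.exists_linearEquiv {e : OpenPartialHomeomorph M M}
    (h : IsFlowComposite ζ e) : ∃ A : 𝔤 ≃ₗ[ℝ] 𝔤, ∀ x ∈ e.source, ∀ X,
      mfderiv 𝓘(ℝ, E) 𝓘(ℝ, E) e x (ζ X x) = ζ (A X) (e x) := by
  induction h with
  | flow Y t e h =>
    obtain ⟨A, hA0, hA⟩ := exists_isTransported_linearEquiv ζ Y
    refine ⟨A t, fun x hx X => ?_⟩
    have := mfderiv_of_flowsTo e.open_source h (hA X) hx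
    rwa [hA0] at this
  | comp e e' he he' ih ih' =>
    obtain ⟨A, hA⟩ := ih
    obtain ⟨A', hA'⟩ := ih'
    refine ⟨A.trans A', fun x hx X => ?_⟩
    rw [he.mfderiv_trans he' hx]
    rw [OpenPartialHomeomorph.trans_source] at hx
    rw [hA x hx.1, hA' _ hx.2]
    rfl

end Adjoint

/-! ### Transitivity on points and effectiveness on germs. -/

section Transitive

/-- Two points are joined by compositions of flows, for a transitive action on a connected
manifold. -/
theorem IsTransitive.exists_isFlowComposite [ConnectedSpace M] (hζ : IsTransitive ζ) (x y : M) :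
    ∃ e, IsFlowComposite ζ e ∧ x ∈ e.source ∧ e x = y := by
  -- `R` is symmetric and transitive, and local sections show that every point is related to all
  -- nearby points, so connectedness applies.
  let R : M → M → Prop := fun x y => ∃ e, IsFlowComposite ζ e ∧ x ∈ e.source ∧ e x = y
  have hsymm : Std.Symm R := ⟨by
    rintro x y ⟨e, he, hxe, rfl⟩
    exact ⟨e.symm, he.symm, e.map_source hxe, e.left_inv hxe⟩⟩
  have htrans : IsTrans M R := ⟨by
    rintro x y z ⟨e, he, hxe, rfl⟩ ⟨e', he', hye', rfl⟩
    exact ⟨e.trans e', .comp _ _ he he', by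
      rw [OpenPartialHomeomorph.trans_source]; exact ⟨hxe, hye'⟩, rfl⟩⟩
  refine PreconnectedSpace.induction₂ R (fun y => ?_) htrans x y
  obtain ⟨W, U, τ, X, G, hW, hyW, hU, hyU, -, hG, hGF⟩ := hζ.exists_localSection y
  filter_upwards [hW.mem_nhds hyW] with z hz
  obtain ⟨e, he, heG⟩ := exists_openPartialHomeomorph_of_flowsTo hU (hGF z hz)
  refine ⟨e, .flow (X z) τ e fun x hx => ?_, he ▸ hyU, by rw [heG, hG z hz]⟩
  rw [heG]
  exact hGF z hz x (he ▸ hx)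

variable (ζ) in
/-- The elements whose fundamental field vanishes near a point. -/
def germKernel (y : M) : Submodule ℝ 𝔤 where
  carrier := {X | ∀ᶠ x in 𝓝 y, ζ X x = 0}
  add_mem' {X Y} hX hY := by
    filter_upwards [hX, hY] with x h1 h2
    rw [map_add]
    exact (congrArg₂ (· + ·) h1 h2).trans (add_zero _)
  zero_mem' := by
    refine Eventually.of_forall fun x => ?_
    rw [map_zero]
    rfl
  smul_mem' c X hX := by
    filter_upwards [hX] with x h1
    rw [map_smul]
    exact (congrArg (c • ·) h1).trans (smul_zero _)

theorem mem_germKernel {y : M} {X : 𝔤} : X ∈ germKernel ζ y ↔ ∀ᶠ x in 𝓝 y, ζ X x = 0 := Iff.rfl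

variable [FiniteDimensional ℝ 𝔤]

/-- The linear automorphism attached to `e` maps the kernel at `x` into the kernel at `e x`. As any
two points are joined in both directions, the dimension is constant. -/
theorem IsFlowComposite.finrank_germKernel_le {e : OpenPartialHomeomorph M M}
    (h : IsFlowComposite ζ e) {x : M} (hx : x ∈ e.source) :
    Module.finrank ℝ (germKernel ζ x) ≤ Module.finrank ℝ (germKernel ζ (e x)) := by
  obtain ⟨A, hA⟩ := h.exists_linearEquiv
  have hle : (germKernel ζ x).map A.toLinearMap ≤ germKernel ζ (e x) := by
    rw [Submodule.map_le_iff_le_comap]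
    intro X hX
    rw [Submodule.mem_comap, mem_germKernel]
    have h1 := (e.tendsto_symm hx).eventually (mem_germKernel.mp hX)
    filter_upwards [h1, e.open_target.mem_nhds (e.map_source hx)] with y h2 h3
    have h4 := hA _ (e.map_target h3) X
    rw [h2, map_zero, e.right_inv h3] at h4
    exact h4.symm
  rw [← LinearEquiv.finrank_map_eq A]
  exact Submodule.finrank_mono hle

/-- An effective transitive action is effective on germs. -/
theorem germKernel_eq_bot [ConnectedSpace M] (hζ : IsTransitive ζ) (hζe : IsEffective ζ) (y : M) :
    germKernel ζ y = ⊥ := by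
  have hrank : ∀ x z : M, Module.finrank ℝ (germKernel ζ x) ≤ Module.finrank ℝ (germKernel ζ z) := by
    intro x z
    obtain ⟨e, he, hx, rfl⟩ := hζ.exists_isFlowComposite x z
    exact he.finrank_germKernel_le hx
  -- A finite basis of the kernel at `x` consists of elements whose fields also vanish near every
  -- nearby `z`, so the kernel can only grow. Constant dimension turns the inclusion into equality.
  -- On connected `M` the kernel is then the same everywhere, and its elements have zero fundamental
  -- field.
  have hloc : IsLocallyConstant (germKernel ζ : M → Submodule ℝ 𝔤) := by
    rw [IsLocallyConstant.iff_eventually_eq]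
    intro x
    have h1 : ∀ᶠ z in 𝓝 x, ∀ i, ((Module.finBasis ℝ (germKernel ζ x) i : germKernel ζ x) : 𝔤) ∈
        germKernel ζ z := by
      rw [eventually_all]
      intro i
      exact (mem_germKernel.mp (Module.finBasis ℝ (germKernel ζ x) i).2).eventually_nhds
    filter_upwards [h1] with z hz
    refine (Submodule.eq_of_le_of_finrank_le (fun X hX => ?_) (hrank z x)).symm
    have h2 : (_ : 𝔤) = X := congrArg Subtype.val
      ((Module.finBasis ℝ (germKernel ζ x)).sum_repr ⟨X, hX⟩)
    rw [← h2, AddSubmonoidClass.coe_finsetSum]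
    exact Submodule.sum_mem _ fun i _ => Submodule.smul_mem _ _ (hz i)
  rw [eq_bot_iff]
  intro X hX
  rw [Submodule.mem_bot]
  refine hζe ?_
  rw [map_zero]
  ext z
  have h1 : X ∈ germKernel ζ z := by
    rwa [hloc.apply_eq_of_preconnectedSpace z y]
  exact (mem_germKernel.mp h1).self_of_nhds

theorem eq_of_eventually_eq [ConnectedSpace M] (hζ : IsTransitive ζ) (hζe : IsEffective ζ) {y : M}
    {X Y : 𝔤} (h : ∀ᶠ x in 𝓝 y, ζ X x = ζ Y x) : X = Y := by
  have h1 : X - Y ∈ germKernel ζ y := by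
    rw [mem_germKernel]
    filter_upwards [h] with x hx
    rw [map_sub]
    exact sub_eq_zero.mpr hx
  rw [germKernel_eq_bot hζ hζe, Submodule.mem_bot] at h1
  exact sub_eq_zero.mp h1

/-- A composition of flows acts on the fundamental fields by a Lie algebra automorphism. -/
theorem IsFlowComposite.exists_lieEquiv [ConnectedSpace M] (hζ : IsTransitive ζ)
    (hζe : IsEffective ζ) {e : OpenPartialHomeomorph M M} (h : IsFlowComposite ζ e)
    (hne : e.source.Nonempty) : ∃ A : 𝔤 ≃ₗ⁅ℝ⁆ 𝔤, ∀ x ∈ e.source, ∀ X,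
      mfderiv 𝓘(ℝ, E) 𝓘(ℝ, E) e x (ζ X x) = ζ (A X) (e x) := by
  have := FiniteDimensional.complete ℝ E
  have h2 : minSmoothness ℝ 2 ≤ (∞ : WithTop ℕ∞) := by
    rw [minSmoothness_of_isRCLikeNormedField]
    exact WithTop.coe_le_coe.mpr le_top
  have : IsManifold 𝓘(ℝ, E) (minSmoothness ℝ 2) M := IsManifold.of_le (n := ∞) h2
  obtain ⟨A, hA⟩ := h.exists_linearEquiv
  have hinv : ∀ x ∈ e.source, (mfderiv 𝓘(ℝ, E) 𝓘(ℝ, E) e x).IsInvertible := fun x hx =>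
    ⟨h.mdifferentiable.mfderiv hx, rfl⟩
  have hpull : ∀ X, ∀ x ∈ e.source,
      mpullback 𝓘(ℝ, E) 𝓘(ℝ, E) e (fun y => ζ (A X) y) x = ζ X x := by
    intro X x hx
    rw [mpullback_apply, ← hA x hx X]
    exact (hinv x hx).inverse_apply_self _
  -- Pullback respects brackets, so the fields of `A ⁅X, Y⁆` and `⁅A X, A Y⁆` agree on the image of
  -- `e`. The image must be nonempty to conclude through germs.
  have hlie : ∀ X Y, A ⁅X, Y⁆ = ⁅A X, A Y⁆ := by
    intro X Y
    obtain ⟨x₁, hx₁⟩ := hne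
    refine eq_of_eventually_eq hζ hζe (y := e x₁) ?_
    filter_upwards [e.open_target.mem_nhds (e.map_source hx₁)] with y hy
    have hx := e.map_target hy
    set x := e.symm y with hxy
    have hex : e x = y := e.right_inv hy
    have h3 := mpullback_mlieBracket (n := ∞) ((ζ (A X)).mdiff (e x)) ((ζ (A Y)).mdiff (e x))
      (h.contMDiffAt hx) h2
    have h4 : ∀ X, mpullback 𝓘(ℝ, E) 𝓘(ℝ, E) e (fun y => ζ (A X) y) =ᶠ[𝓝 x] fun z => ζ X z :=
      fun X => by filter_upwards [e.open_source.mem_nhds hx] with z hz using hpull X z hz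
    rw [(h4 X).mlieBracket_vectorField_eq (h4 Y), ← VField.bracket_apply, ← LieHom.map_lie] at h3
    have h5 := hA x hx ⁅X, Y⁆
    rw [← h3, mpullback_apply] at h5
    have h6 := h5.symm.trans ((hinv x hx).self_apply_inverse _)
    rw [← VField.bracket_apply, ← LieHom.map_lie, hex] at h6
    exact h6
  exact ⟨{ A with map_lie' := fun {X Y} => hlie X Y }, hA⟩

end Transitive

end Composites

/-! ### Smooth dependence of derivatives in families. -/

section FamilyDerivative

variable {E : Type*} [NormedAddCommGroup E] [NormedSpace ℝ E]
  {M : Type*} [TopologicalSpace M] [ChartedSpace E M] [IsManifold 𝓘(ℝ, E) ∞ M]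
  {F : Type*} [NormedAddCommGroup F] [NormedSpace ℝ F]
  {N : Type*} [TopologicalSpace N] [ChartedSpace F N] [IsManifold 𝓘(ℝ, F) ∞ N]

theorem mfderiv_inr_apply {f : N × M → M} {q : N × M}
    (hf : MDifferentiableAt (𝓘(ℝ, F).prod 𝓘(ℝ, E)) 𝓘(ℝ, E) f q)
    (v : TangentSpace 𝓘(ℝ, E) q.2) :
    mfderiv (𝓘(ℝ, F).prod 𝓘(ℝ, E)) 𝓘(ℝ, E) f q (0, v) =
      mfderiv 𝓘(ℝ, E) 𝓘(ℝ, E) (fun x => f (q.1, x)) q.2 v := by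
  have h := HasMFDerivAt.comp (f := fun x : M => (q.1, x)) q.2 hf.hasMFDerivAt
    ((hasMFDerivAt_const q.1 q.2).prodMk (hasMFDerivAt_id q.2))
  exact (DFunLike.congr_fun h.mfderiv v).symm

/-- The derivatives of a smooth family of maps along a vector field depend smoothly on the
parameter. -/
theorem contMDiffOn_mfderiv_family {G : N → M → M} {W : Set N} {U : Set M} (hW : IsOpen W)
    (hU : IsOpen U) (hG : ContMDiffOn (𝓘(ℝ, F).prod 𝓘(ℝ, E)) 𝓘(ℝ, E) ∞
      (fun q : N × M => G q.1 q.2) (W ×ˢ U)) (V : VField E M) :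
    ContMDiffOn (𝓘(ℝ, F).prod 𝓘(ℝ, E)) 𝓘(ℝ, E).tangent ∞
      (fun q : N × M => (⟨G q.1 q.2, mfderiv 𝓘(ℝ, E) 𝓘(ℝ, E) (G q.1) q.2 (V q.2)⟩ :
        TangentBundle 𝓘(ℝ, E) M)) (W ×ˢ U) := by
  have : IsManifold 𝓘(ℝ, E) 1 M := IsManifold.of_le (n := ∞) (by simp)
  have : IsManifold 𝓘(ℝ, F) 1 N := IsManifold.of_le (n := ∞) (by simp)
  have hWU : IsOpen (W ×ˢ U) := hW.prod hU
  -- The derivative of each member along `V` is the tangent map of the whole family applied to the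
  -- smooth field `(0, V)` on the product.
  have h1 := hG.contMDiffOn_tangentMapWithin (m := ∞) (by simp) hWU.uniqueMDiffOn
  have h2 : ContMDiff (𝓘(ℝ, F).prod 𝓘(ℝ, E)) (𝓘(ℝ, F).tangent.prod 𝓘(ℝ, E).tangent) ∞
      (fun q : N × M => ((⟨q.1, 0⟩ : TangentBundle 𝓘(ℝ, F) N),
        (⟨q.2, V q.2⟩ : TangentBundle 𝓘(ℝ, E) M))) :=
    ((Bundle.contMDiff_zeroSection ℝ (TangentSpace 𝓘(ℝ, F) : N → Type _)).comp
      contMDiff_fst).prodMk (V.contMDiff.comp contMDiff_snd)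
  have h3 : ContMDiff (𝓘(ℝ, F).prod 𝓘(ℝ, E)) (𝓘(ℝ, F).prod 𝓘(ℝ, E)).tangent ∞
      (fun q : N × M => (⟨q, (0, V q.2)⟩ : TangentBundle (𝓘(ℝ, F).prod 𝓘(ℝ, E)) (N × M))) :=
    contMDiff_equivTangentBundleProd_symm.comp h2
  refine (h1.comp h3.contMDiffOn (fun q hq => hq)).congr fun q hq => ?_
  have h6 : mfderivWithin (𝓘(ℝ, F).prod 𝓘(ℝ, E)) 𝓘(ℝ, E) (fun q : N × M => G q.1 q.2) (W ×ˢ U) q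
      (0, V q.2) = mfderiv 𝓘(ℝ, E) 𝓘(ℝ, E) (G q.1) q.2 (V q.2) := by
    rw [mfderivWithin_of_isOpen hWU hq]
    exact mfderiv_inr_apply ((hG.contMDiffAt (hWU.mem_nhds hq)).mdifferentiableAt (by simp)) _
  exact (congrArg (Bundle.TotalSpace.mk (F := E) (G q.1 q.2)) h6).symm

end FamilyDerivative

/-! ### The germ space, `Ad` and the normalizer in terms of compositions of flows. -/

section Germs

variable {E : Type*} [NormedAddCommGroup E] [NormedSpace ℝ E] [FiniteDimensional ℝ E]
  {M : Type*} [TopologicalSpace M] [T2Space M] [ChartedSpace E M] [IsManifold 𝓘(ℝ, E) ∞ M]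
  {𝔤 : Type*} [LieRing 𝔤] [LieAlgebra ℝ 𝔤] {ζ : 𝔤 →ₗ⁅ℝ⁆ VField E M} {x₀ : M}

theorem push_coe (f : M → M) (V : VField E M) :
    push (f : (𝓝 x₀).Germ M) V = ((fun x => (⟨f x, mfderiv 𝓘(ℝ, E) 𝓘(ℝ, E) f x (V x)⟩ :
      TangentBundle 𝓘(ℝ, E) M)) : (𝓝 x₀).Germ (TangentBundle 𝓘(ℝ, E) M)) := rfl

theorem along_coe (f : M → M) (V : VField E M) :
    along V (f : (𝓝 x₀).Germ M) = ((fun x => (⟨f x, V (f x)⟩ : TangentBundle 𝓘(ℝ, E) M)) :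
      (𝓝 x₀).Germ (TangentBundle 𝓘(ℝ, E) M)) := rfl

theorem IsFlowComposite.exists_mem_pseudogroup {e : OpenPartialHomeomorph M M}
    (h : IsFlowComposite ζ e) {C : Set M} (hC : IsOpen C) (hCc : IsConnected C)
    (hCe : C ⊆ e.source) : ∃ e' ∈ pseudogroup ζ, e'.source = C ∧ (e' : M → M) = e := by
  have hs : ((OpenPartialHomeomorph.ofSet C hC).trans e).source = C := by
    rw [OpenPartialHomeomorph.trans_source]
    exact inter_eq_left.mpr hCe
  exact ⟨_, ⟨by rwa [hs], fun x hx => ⟨_, .comp _ _ (isFlowComposite_ofSet ζ hC) h, hx,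
    EventuallyEq.rfl⟩⟩, hs, rfl⟩

theorem exists_isOpen_isConnected (E : Type*) [NormedAddCommGroup E] [NormedSpace ℝ E]
    {M : Type*} [TopologicalSpace M] [ChartedSpace E M] {x : M} {O : Set M} (hO : IsOpen O) (hx : x ∈ O) :
    ∃ C, IsOpen C ∧ IsConnected C ∧ x ∈ C ∧ C ⊆ O :=
  have := ChartedSpace.locallyConnectedSpace E M
  ⟨connectedComponentIn O x, hO.connectedComponentIn, isConnected_connectedComponentIn_iff.mpr hx,
    mem_connectedComponentIn hx, connectedComponentIn_subset O x⟩

/-- Manifolds are locally connected, so domains can be shrunk to connected ones. At the level of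
germs only compositions of flows matter. -/
theorem mem_germSpace_iff {φ : (𝓝 x₀).Germ M} : φ ∈ germSpace ζ x₀ ↔
    ∃ e : OpenPartialHomeomorph M M, IsFlowComposite ζ e ∧ x₀ ∈ e.source ∧ φ = (e : M → M) := by
  constructor
  · rintro ⟨e, ⟨-, he⟩, hx, rfl⟩
    obtain ⟨e', he', hx', h⟩ := he x₀ hx
    exact ⟨e', he', hx', Germ.coe_eq.mpr h⟩
  · rintro ⟨e, he, hx, rfl⟩
    obtain ⟨C, hC, hCc, hxC, hCe⟩ := exists_isOpen_isConnected E e.open_source hx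
    obtain ⟨e', he', rfl, hee⟩ := he.exists_mem_pseudogroup hC hCc hCe
    exact ⟨e', he', hxC, by rw [hee]⟩

variable [FiniteDimensional ℝ 𝔤] [ConnectedSpace M]

theorem exists_isAd (hζ : IsTransitive ζ) (hζe : IsEffective ζ) {φ : (𝓝 x₀).Germ M}
    (hφ : φ ∈ germSpace ζ x₀) : ∃ A, IsAd ζ φ A := by
  obtain ⟨e, he, hx, rfl⟩ := mem_germSpace_iff.mp hφ
  obtain ⟨A, hA⟩ := he.exists_lieEquiv hζ hζe ⟨x₀, hx⟩
  refine ⟨A, fun X => ?_⟩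
  rw [push_coe, along_coe, Germ.coe_eq]
  filter_upwards [e.open_source.mem_nhds hx] with x hx
  rw [hA x hx]

theorem IsAd.unique (hζ : IsTransitive ζ) (hζe : IsEffective ζ) {φ : (𝓝 x₀).Germ M}
    (hφ : φ ∈ germSpace ζ x₀) {A B : 𝔤 ≃ₗ⁅ℝ⁆ 𝔤} (hA : IsAd ζ φ A) (hB : IsAd ζ φ B) : A = B := by
  obtain ⟨e, he, hx, rfl⟩ := mem_germSpace_iff.mp hφ
  ext X
  have h1 := (hA X).symm.trans (hB X)
  rw [along_coe, along_coe, Germ.coe_eq] at h1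
  refine eq_of_eventually_eq hζ hζe (y := e x₀) ?_
  -- The equality holds along `e` near `x₀`. The local inverse of `e` carries it to all points near
  -- `e x₀`.
  filter_upwards [(e.tendsto_symm hx).eventually h1, e.open_target.mem_nhds (e.map_source hx)]
    with y h2 h3
  have h4 := Bundle.TotalSpace.mk_injective _ h2
  rwa [e.right_inv h3] at h4

theorem isAd_ad (hζ : IsTransitive ζ) (hζe : IsEffective ζ) {φ : (𝓝 x₀).Germ M}
    (hφ : φ ∈ germSpace ζ x₀) : IsAd ζ φ (Ad ζ φ) :=
  Classical.epsilon_spec (exists_isAd hζ hζe hφ)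

theorem push_value (hζ : IsTransitive ζ) (hζe : IsEffective ζ) {φ : (𝓝 x₀).Germ M}
    (hφ : φ ∈ germSpace ζ x₀) (X : 𝔤) :
    (push φ (ζ X)).value = ⟨φ.value, ζ (Ad ζ φ X) φ.value⟩ := by
  rw [isAd_ad hζ hζe hφ X]
  obtain ⟨e, he, hx, rfl⟩ := mem_germSpace_iff.mp hφ
  rfl

/-- For an isotropy element, `Te.ζ_X(x₀)` equals `ζ_{Ad(e)X}(x₀)`. The normalizer condition
therefore says that the linear isotropy representation fixes `ζ_X(x₀)`. -/
theorem mem_normalizer_iff (hζ : IsTransitive ζ) (hζe : IsEffective ζ) {X : 𝔤} :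
    X ∈ normalizer ζ x₀ ↔ ∀ e : OpenPartialHomeomorph M M, IsFlowComposite ζ e → x₀ ∈ e.source →
      e x₀ = x₀ → mfderiv 𝓘(ℝ, E) 𝓘(ℝ, E) e x₀ (ζ X x₀) = ζ X (e x₀) := by
  have key : ∀ e : OpenPartialHomeomorph M M, IsFlowComposite ζ e → x₀ ∈ e.source → e x₀ = x₀ →
      (Ad ζ ((e : M → M) : (𝓝 x₀).Germ M) X - X ∈ isotropyAlgebra ζ x₀ ↔
        mfderiv 𝓘(ℝ, E) 𝓘(ℝ, E) e x₀ (ζ X x₀) = ζ X (e x₀)) := by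
    intro e he hx hex
    have h1 := Bundle.TotalSpace.mk_injective _
      (push_value hζ hζe (mem_germSpace_iff.mpr ⟨e, he, hx, rfl⟩) X)
    rw [h1]
    change ζ (_ - X) x₀ = 0 ↔ ζ (Ad ζ ((e : M → M) : (𝓝 x₀).Germ M) X) (e x₀) = _
    rw [hex, map_sub]
    exact sub_eq_zero
  constructor
  · intro h e he hx hex
    exact (key e he hx hex).mp (h _ ⟨mem_germSpace_iff.mpr ⟨e, he, hx, rfl⟩, hex⟩)
  · rintro h ψ ⟨hψ, hψx⟩
    obtain ⟨e, he, hx, rfl⟩ := mem_germSpace_iff.mp hψ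
    exact (key e he hx hψx).mpr (h e he hx hψx)

end Germs

/-! ### Centralizing fields as invariant fields, and the Weyl algebra. -/

section Centralizer

variable {E : Type*} [NormedAddCommGroup E] [NormedSpace ℝ E] [FiniteDimensional ℝ E]
  {M : Type*} [TopologicalSpace M] [T2Space M] [ChartedSpace E M] [IsManifold 𝓘(ℝ, E) ∞ M]
  {𝔤 : Type*} [LieRing 𝔤] [LieAlgebra ℝ 𝔤] {ζ : 𝔤 →ₗ⁅ℝ⁆ VField E M} {x₀ : M}

/-- A field that is invariant under all compositions of flows commutes with the action. -/
theorem mem_centralizer_of_mfderiv {η : VField E M}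
    (hη : ∀ e : OpenPartialHomeomorph M M, IsFlowComposite ζ e → ∀ x ∈ e.source,
      mfderiv 𝓘(ℝ, E) 𝓘(ℝ, E) e x (η x) = η (e x)) : η ∈ centralizer ζ := by
  intro Y
  rw [← lie_skew, neg_eq_zero]
  ext x
  obtain ⟨δ, U, Fl, hxU, hFl, -, hcomm⟩ := exists_isLocalFlow (ζ Y) x
  refine hcomm η x hxU ?_
  filter_upwards [Ioo_mem_nhds (neg_lt_zero.mpr hFl.pos) hFl.pos] with t ht
  have hflow : ∀ z ∈ U, FlowsTo (ζ Y) t z (Fl t z) := fun z hz => by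
    have := FlowsTo.of_isMIntegralCurveOn (s := 0) (t := t) (hFl.curve z hz)
      (ordConnected_Ioo.uIcc_subset ⟨neg_lt_zero.mpr hFl.pos, hFl.pos⟩ ht)
    rwa [sub_zero, hFl.zero z hz] at this
  obtain ⟨e, he, heF⟩ := exists_openPartialHomeomorph_of_flowsTo hFl.isOpen hflow
  have := hη e (.flow Y t e fun z hz => by rw [heF]; exact hflow z (he ▸ hz)) x (he ▸ hxU)
  rwa [heF] at this

variable [ConnectedSpace M]

/-- Invariance under compositions of flows propagates the value at `x₀` to all of `M`. Every later
identity between centralizing fields reduces to one at `x₀`. -/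
theorem eq_of_mem_centralizer (hζ : IsTransitive ζ) {η θ : VField E M} (hη : η ∈ centralizer ζ)
    (hθ : θ ∈ centralizer ζ) (h : η x₀ = θ x₀) : η = θ := by
  ext x
  obtain ⟨e, he, hx, rfl⟩ := hζ.exists_isFlowComposite x₀ x
  rw [← he.mfderiv_of_mem_centralizer hη hx, ← he.mfderiv_of_mem_centralizer hθ hx, h]

/-- The isotropy-invariant vector `ζ_X(x₀)` is carried to every point by a chosen composition of
flows. -/
theorem exists_mem_centralizer (hζ : IsTransitive ζ) [FiniteDimensional ℝ 𝔤] {X : 𝔤}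
    (hX : ∀ e : OpenPartialHomeomorph M M, IsFlowComposite ζ e → x₀ ∈ e.source →
      e x₀ = x₀ → mfderiv 𝓘(ℝ, E) 𝓘(ℝ, E) e x₀ (ζ X x₀) = ζ X (e x₀)) :
    ∃ η ∈ centralizer ζ, η x₀ = ζ X x₀ := by
  choose e he hes hez using hζ.exists_isFlowComposite x₀
  let η : ∀ z : M, TangentSpace 𝓘(ℝ, E) z := fun z =>
    (mfderiv 𝓘(ℝ, E) 𝓘(ℝ, E) (e z) x₀ (ζ X x₀) : E)
  -- the definition does not depend on the chosen compositions of flows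
  have hη : ∀ f : OpenPartialHomeomorph M M, IsFlowComposite ζ f → x₀ ∈ f.source →
      mfderiv 𝓘(ℝ, E) 𝓘(ℝ, E) f x₀ (ζ X x₀) = η (f x₀) := by
    intro f hf hfs
    have hft : f x₀ ∈ (e (f x₀)).target := by
      have := (e (f x₀)).map_source (hes (f x₀))
      rwa [hez] at this
    set e₁ := e (f x₀) with he₁
    -- Following `f` and returning along `e₁` is an isotropy element, which fixes `ζ_X(x₀)` by `hX`.
    have hg : IsFlowComposite ζ (f.trans e₁.symm) := .comp _ _ hf (he _).symm
    have hgs : x₀ ∈ (f.trans e₁.symm).source := by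
      rw [OpenPartialHomeomorph.trans_source]
      exact ⟨hfs, hft⟩
    have hgx : (f.trans e₁.symm) x₀ = x₀ := by
      have := e₁.left_inv (hes (f x₀))
      rwa [hez] at this
    have hgs' : x₀ ∈ ((f.trans e₁.symm).trans e₁).source := by
      rw [OpenPartialHomeomorph.trans_source]
      refine ⟨hgs, ?_⟩
      rw [mem_preimage, hgx]
      exact hes _
    have h1 : (f : M → M) =ᶠ[𝓝 x₀] ((f.trans e₁.symm).trans e₁) := by
      filter_upwards [(f.trans e₁.symm).open_source.mem_nhds hgs] with z hz
      rw [OpenPartialHomeomorph.trans_source] at hz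
      exact (e₁.right_inv hz.2).symm
    have h2 := hg.mfderiv_trans (he (f x₀)) hgs' (ζ X x₀)
    rw [hX _ hg hgs hgx] at h2
    have h3 := congrArg (fun x => (mfderiv 𝓘(ℝ, E) 𝓘(ℝ, E) e₁ x (ζ X x) : E)) hgx
    rw [h1.mfderiv_eq]
    exact h2.trans h3
  have hηinv : ∀ f : OpenPartialHomeomorph M M, IsFlowComposite ζ f → ∀ x ∈ f.source,
      mfderiv 𝓘(ℝ, E) 𝓘(ℝ, E) f x (η x) = η (f x) := by
    intro f hf x hx
    obtain ⟨e', he', hx', rfl⟩ := hζ.exists_isFlowComposite x₀ x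
    have hs : x₀ ∈ (e'.trans f).source := by
      rw [OpenPartialHomeomorph.trans_source]
      exact ⟨hx', hx⟩
    rw [← hη e' he' hx', ← he'.mfderiv_trans hf hs]
    exact hη _ (.comp _ _ he' hf) hs
  have hsmooth : ContMDiff 𝓘(ℝ, E) 𝓘(ℝ, E).tangent ∞
      (fun z => (⟨z, η z⟩ : TangentBundle 𝓘(ℝ, E) M)) := by
    intro y
    -- At `y` the field `η` has the value of the smooth field `ζ (A X)`. By invariance, `η z` for
    -- `z` near `y` is the derivative of `G z` applied to this value, which depends smoothly on `z`.
    obtain ⟨A, hA⟩ := (he y).exists_linearEquiv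
    have hAy : η y = ζ (A X) y := by
      have := (hη _ (he y) (hes y)).symm.trans (hA x₀ (hes y) X)
      rwa [hez] at this
    obtain ⟨W, U, τ, Z, G, hW, hyW, hU, hyU, hG, hGy, hGF⟩ := hζ.exists_localSection y
    have h1 := contMDiffOn_mfderiv_family hW hU hG (ζ (A X))
    have h2 : ContMDiffOn 𝓘(ℝ, E) 𝓘(ℝ, E).tangent ∞
        (fun z => (⟨G z y, mfderiv 𝓘(ℝ, E) 𝓘(ℝ, E) (G z) y (ζ (A X) y)⟩ :
          TangentBundle 𝓘(ℝ, E) M)) W :=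
      h1.comp (contMDiffOn_id.prodMk contMDiffOn_const) fun z hz => ⟨hz, hyU⟩
    refine (h2.contMDiffAt (hW.mem_nhds hyW)).congr_of_eventuallyEq ?_
    filter_upwards [hW.mem_nhds hyW] with z hz
    obtain ⟨f, hfs, hfG⟩ := exists_openPartialHomeomorph_of_flowsTo hU (hGF z hz)
    have h3 := hηinv f (.flow (Z z) τ f fun x hx => by rw [hfG]; exact hGF z hz x (hfs ▸ hx)) y
      (hfs ▸ hyU)
    rw [hfG, hAy] at h3
    rw [h3, hGy z hz]
  refine ⟨⟨η, hsmooth⟩, mem_centralizer_of_mfderiv hηinv, ?_⟩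
  have := hη _ (isFlowComposite_ofSet ζ isOpen_univ) (mem_univ x₀)
  rw [OpenPartialHomeomorph.ofSet_apply] at this
  refine Eq.trans this.symm ?_
  exact DFunLike.congr_fun mfderiv_id (ζ X x₀)

variable [FiniteDimensional ℝ 𝔤]

/-- The normalizer consists of the elements whose field agrees at the base point with a field of
the centralizer. -/
theorem mem_normalizer_iff_exists (hζ : IsTransitive ζ) (hζe : IsEffective ζ) {X : 𝔤} :
    X ∈ normalizer ζ x₀ ↔ ∃ η ∈ centralizer ζ, η x₀ = ζ X x₀ := by
  rw [mem_normalizer_iff hζ hζe]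
  refine ⟨exists_mem_centralizer hζ, ?_⟩
  rintro ⟨η, hη, h⟩ e he hx hex
  have h1 := he.mfderiv_of_mem_centralizer hη hx
  rw [← h, h1, hex, h]

variable (ζ) in
/-- The centralizer as a Lie subalgebra. -/
def centralizerSubalgebra : LieSubalgebra ℝ (VField E M) where
  carrier := centralizer ζ
  add_mem' {η θ} hη hθ X := by rw [add_lie, hη X, hθ X, add_zero]
  zero_mem' X := zero_lie _
  smul_mem' c η hη X := by rw [smul_lie, hη X, smul_zero]
  lie_mem' {η θ} hη hθ X := by rw [lie_lie, hη X, hθ X, lie_zero, lie_zero, sub_zero]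

/-- `ζ X - η` and `ζ Y - θ` vanish at `x₀`, hence so does their bracket. The mixed terms are zero,
leaving `ζ ⁅X, Y⁆ + ⁅η, θ⁆`, and this is where the sign of the anti-homomorphism arises. -/
theorem lie_apply_of_mem_centralizer {η θ : VField E M} (hη : η ∈ centralizer ζ)
    (hθ : θ ∈ centralizer ζ) {X Y : 𝔤} (hX : η x₀ = ζ X x₀) (hY : θ x₀ = ζ Y x₀) :
    (-⁅η, θ⁆) x₀ = ζ ⁅X, Y⁆ x₀ := by
  have h1 : ⁅ζ X - η, ζ Y - θ⁆ x₀ = 0 := by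
    rw [VField.bracket_apply, ← mlieBracketWithin_univ]
    exact mlieBracketWithin_eq_zero_of_eq_zero (sub_eq_zero.mpr hX.symm) (sub_eq_zero.mpr hY.symm)
  have h2 : ⁅ζ X - η, ζ Y - θ⁆ = ζ ⁅X, Y⁆ - -⁅η, θ⁆ := by
    have h3 : ⁅ζ X, θ⁆ = 0 := by rw [← lie_skew, hθ X, neg_zero]
    rw [sub_lie, lie_sub, lie_sub, h3, hη Y, LieHom.map_lie]
    abel
  rw [h2] at h1
  exact (sub_eq_zero.mp h1).symm

/-- The Weyl algebra of the action and its identification with the centralizer. -/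
theorem exists_weylAlgebra (hζ : IsTransitive ζ) (hζe : IsEffective ζ) (x₀ : M) :
    ∃ (N : LieSubalgebra ℝ 𝔤) (J : LieIdeal ℝ N) (ζhat : (N ⧸ J) →ₗ[ℝ] VField E M),
      (N : Set 𝔤) = normalizer ζ x₀ ∧ isotropyAlgebra ζ x₀ ≤ N ∧
      (∀ X : N, X ∈ J ↔ (X : 𝔤) ∈ isotropyAlgebra ζ x₀) ∧
      (∀ a b : N ⧸ J, ζhat ⁅a, b⁆ = -⁅ζhat a, ζhat b⁆) ∧
      ∀ X : N, ζhat (LieSubmodule.Quotient.mk X) ∈ centralizer ζ ∧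
        ζhat (LieSubmodule.Quotient.mk X) x₀ = ζ X x₀ := by
  let C := centralizerSubalgebra ζ
  -- Describing `N` by centralizing fields reduces closure to that of the centralizer. The equality
  -- with the normalizer is `mem_normalizer_iff_exists`.
  let N : LieSubalgebra ℝ 𝔤 :=
    { carrier := {X | ∃ η ∈ centralizer ζ, η x₀ = ζ X x₀}
      add_mem' := by
        rintro X Y ⟨η, hη, hX⟩ ⟨θ, hθ, hY⟩
        refine ⟨η + θ, C.add_mem hη hθ, ?_⟩
        rw [map_add]
        exact congrArg₂ (· + ·) hX hY
      zero_mem' := ⟨0, C.zero_mem, by rw [map_zero]⟩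
      smul_mem' := by
        rintro c X ⟨η, hη, hX⟩
        refine ⟨c • η, C.smul_mem c hη, ?_⟩
        rw [map_smul]
        exact congrArg (c • ·) hX
      lie_mem' := by
        rintro X Y ⟨η, hη, hX⟩ ⟨θ, hθ, hY⟩
        exact ⟨-⁅η, θ⁆, C.neg_mem (C.lie_mem hη hθ), lie_apply_of_mem_centralizer hη hθ hX hY⟩ }
  have hN : ∀ X : N, ∃ η, η ∈ centralizer ζ ∧ η x₀ = ζ X x₀ := fun X => X.2
  choose f hf hfx using hN
  let J : LieIdeal ℝ N :=
    { carrier := {X | (X : 𝔤) ∈ isotropyAlgebra ζ x₀}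
      add_mem' := fun hX hY => (isotropyAlgebra ζ x₀).add_mem hX hY
      zero_mem' := (isotropyAlgebra ζ x₀).zero_mem
      smul_mem' := fun c _ hX => (isotropyAlgebra ζ x₀).smul_mem c hX
      lie_mem := by
        intro X Y hY
        -- For `Y` in the isotropy algebra the zero field is the matching centralizing field, so the
        -- bracket field vanishes at `x₀`.
        have h1 := lie_apply_of_mem_centralizer (hf X) C.zero_mem (hfx X)
          (show (0 : VField E M) x₀ = ζ Y x₀ from (Eq.symm hY))
        rw [lie_zero, neg_zero] at h1
        exact h1.symm }
  let F : N →ₗ[ℝ] VField E M :=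
    { toFun := f
      map_add' := fun X Y => by
        refine eq_of_mem_centralizer hζ (hf _) (C.add_mem (hf X) (hf Y)) ((hfx _).trans ?_)
        change ζ ((X : 𝔤) + Y) x₀ = f X x₀ + f Y x₀
        rw [hfx, hfx, map_add]
        rfl
      map_smul' := fun c X => by
        refine eq_of_mem_centralizer hζ (hf _) (C.smul_mem c (hf X)) ((hfx _).trans ?_)
        change ζ (c • (X : 𝔤)) x₀ = c • f X x₀
        rw [hfx, map_smul]
        rfl }
  have hJF : J.toSubmodule ≤ LinearMap.ker F := fun X hX =>
    LinearMap.mem_ker.mpr (eq_of_mem_centralizer hζ (hf X) C.zero_mem ((hfx X).trans hX))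
  refine ⟨N, J, J.toSubmodule.liftQ F hJF, ?_, ?_, fun X => Iff.rfl, ?_, fun X => ⟨hf X, hfx X⟩⟩
  · ext X
    exact (mem_normalizer_iff_exists hζ hζe).symm
  · intro X hX
    exact ⟨0, C.zero_mem, hX.symm⟩
  · intro a b
    obtain ⟨X, rfl⟩ := LieSubmodule.Quotient.surjective_mk' J a
    obtain ⟨Y, rfl⟩ := LieSubmodule.Quotient.surjective_mk' J b
    change J.toSubmodule.liftQ F hJF ⁅LieSubmodule.Quotient.mk X, LieSubmodule.Quotient.mk Y⁆ =
      -⁅f X, f Y⁆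
    rw [← LieSubmodule.Quotient.mk_bracket]
    change f ⁅X, Y⁆ = _
    exact eq_of_mem_centralizer hζ (hf _) (C.neg_mem (C.lie_mem (hf X) (hf Y)))
      ((hfx _).trans (lie_apply_of_mem_centralizer (hf X) (hf Y) (hfx X) (hfx Y)).symm)

end Centralizer

/-! ### The dual action on germs, projectability and trajectories. -/

section DualAction

variable {E : Type*} [NormedAddCommGroup E] [NormedSpace ℝ E] [FiniteDimensional ℝ E]
  {M : Type*} [TopologicalSpace M] [T2Space M] [ChartedSpace E M] [IsManifold 𝓘(ℝ, E) ∞ M]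
  {𝔤 : Type*} [LieRing 𝔤] [LieAlgebra ℝ 𝔤] {ζ : 𝔤 →ₗ⁅ℝ⁆ VField E M} {x₀ : M}

/-- It is the velocity at `t = 0` of the curve of germs `e ∘ Fl_t`, where `Fl` is a local flow of `ζ
X`. Precomposition with the flow makes the field act on the source side. -/
theorem dualField_mem_tangentP (X : 𝔤) (φ : germSpace ζ x₀) :
    dualField ζ x₀ X φ ∈ tangentP ζ x₀ φ := by
  obtain ⟨φ, hφ⟩ := φ
  obtain ⟨e, he, hx₀, rfl⟩ := mem_germSpace_iff.mp hφ
  obtain ⟨δ, U₀, Fl, hxU₀, hFl, -⟩ := exists_isLocalFlow (ζ X) x₀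
  have h0δ : (0 : ℝ) ∈ Ioo (-δ) δ := ⟨neg_lt_zero.mpr hFl.pos, hFl.pos⟩
  have hev : ∀ᶠ p : ℝ × M in 𝓝 (0, x₀), p ∈ Ioo (-δ) δ ×ˢ U₀ ∧ Fl p.1 p.2 ∈ e.source := by
    have hnhds : Ioo (-δ) δ ×ˢ U₀ ∈ 𝓝 ((0 : ℝ), x₀) :=
      (isOpen_Ioo.prod hFl.isOpen).mem_nhds ⟨h0δ, hxU₀⟩
    have hcont : ContinuousAt (fun p : ℝ × M => Fl p.1 p.2) (0, x₀) :=
      hFl.smooth.continuousOn.continuousAt hnhds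
    have hsource : e.source ∈ 𝓝 (Fl 0 x₀) := by
      rw [hFl.zero x₀ hxU₀]
      exact e.open_source.mem_nhds hx₀
    filter_upwards [hnhds, hcont hsource] with p h1 h2 using ⟨h1, h2⟩
  obtain ⟨S, O, hS, h0S, hO, hxO, hSO⟩ := mem_nhds_prod_iff'.mp hev
  obtain ⟨U, hU, hUc, hxU, hUO⟩ := exists_isOpen_isConnected E hO hxO
  have hSU : ∀ t ∈ S, ∀ x ∈ U, (t ∈ Ioo (-δ) δ ∧ x ∈ U₀) ∧ Fl t x ∈ e.source :=
    fun t ht x hx => hSO (mk_mem_prod ht (hUO hx))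
  refine ⟨S, U, fun t x => e (Fl t x), ⟨hS, hU, hxU, ?_, fun t ht => ?_⟩, h0S, ?_, ?_⟩
  · exact he.contMDiffOn.comp (hFl.smooth.mono fun p hp => (hSU p.1 hp.1 p.2 hp.2).1)
      fun p hp => (hSU p.1 hp.1 p.2 hp.2).2
  · have hflow : ∀ z ∈ U, FlowsTo (ζ X) t z (Fl t z) := fun z hz => by
      obtain ⟨⟨ht, hz⟩, -⟩ := hSU t ht z hz
      have := FlowsTo.of_isMIntegralCurveOn (s := 0) (t := t) (hFl.curve z hz)
        (ordConnected_Ioo.uIcc_subset h0δ ht)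
      rwa [sub_zero, hFl.zero z hz] at this
    obtain ⟨f, hfs, hfF⟩ := exists_openPartialHomeomorph_of_flowsTo hU hflow
    have hf : IsFlowComposite ζ f :=
      .flow X t f fun z hz => by rw [hfF]; exact hflow z (hfs ▸ hz)
    obtain ⟨e', he', hes, hee⟩ := (IsFlowComposite.comp f e hf he).exists_mem_pseudogroup hU hUc
      (fun z hz => by
        rw [OpenPartialHomeomorph.trans_source, hfs]
        refine ⟨hz, ?_⟩
        rw [mem_preimage, hfF]
        exact (hSU t ht z hz).2)
    refine ⟨e', he', hes, fun z _ => ?_⟩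
    rw [hee, OpenPartialHomeomorph.trans_apply, hfF]
  · refine Germ.coe_eq.mpr ?_
    filter_upwards [hU.mem_nhds hxU] with x hx
    rw [hFl.zero x (hSU 0 h0S x hx).1.2]
  · change push ((e : M → M) : (𝓝 x₀).Germ M) (ζ X) = _
    rw [push_coe]
    refine Germ.coe_eq.mpr ?_
    filter_upwards [hU.mem_nhds hxU] with x hx
    obtain ⟨⟨-, hxU₀⟩, hxe⟩ := hSU 0 h0S x hx
    have h1 := (hFl.curve x hxU₀ 0 h0δ).hasMFDerivAt (Ioo_mem_nhds h0δ.1 h0δ.2)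
    have h2 := HasMFDerivAt.comp (0 : ℝ) (he.mdifferentiableAt hxe).hasMFDerivAt h1
    have h3 : mfderiv 𝓘(ℝ, ℝ) 𝓘(ℝ, E) (fun t : ℝ => e (Fl t x)) 0 (1 : ℝ) =
        mfderiv 𝓘(ℝ, E) 𝓘(ℝ, E) e (Fl 0 x) (ζ X (Fl 0 x)) :=
      (DFunLike.congr_fun h2.mfderiv (1 : ℝ)).trans
        (congrArg (mfderiv 𝓘(ℝ, E) 𝓘(ℝ, E) e (Fl 0 x)) (one_smul ℝ (ζ X (Fl 0 x))))
    rw [h3, hFl.zero x hxU₀]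

theorem isVFieldP_dualField (X : 𝔤) : IsVFieldP ζ x₀ (dualField ζ x₀ X) where
  tangent := dualField_mem_tangentP X
  smooth S U Φ hΦ t₀ ht₀ := by
    refine ⟨S, U, fun t x => ⟨Φ t x, mfderiv 𝓘(ℝ, E) 𝓘(ℝ, E) (Φ t) x (ζ X x)⟩, hΦ.isOpen_times,
      ht₀, Subset.rfl, hΦ.isOpen_domain, hΦ.base_mem,
      contMDiffOn_mfderiv_family hΦ.isOpen_times hΦ.isOpen_domain hΦ.smooth (ζ X), ?_⟩
    rintro t - φ hφ
    rw [dualField, hφ, push_coe]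

theorem projectsTo_iff {X : 𝔤} {η : VField E M} : ProjectsTo ζ x₀ (dualField ζ x₀ X) η ↔
    ∀ e : OpenPartialHomeomorph M M, IsFlowComposite ζ e → x₀ ∈ e.source →
      mfderiv 𝓘(ℝ, E) 𝓘(ℝ, E) e x₀ (ζ X x₀) = η (e x₀) := by
  constructor
  · intro h e he hx
    exact Bundle.TotalSpace.mk_injective _ (h ⟨_, mem_germSpace_iff.mpr ⟨e, he, hx, rfl⟩⟩)
  · rintro h ⟨φ, hφ⟩
    obtain ⟨e, he, hx, rfl⟩ := mem_germSpace_iff.mp hφ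
    exact congrArg (Bundle.TotalSpace.mk (F := E) (e x₀)) (h e he hx)

/-- Both `η` and `V` are invariant under the flow of `V`, so agreement at one point persists along
the trajectory. -/
theorem FlowsTo.eq_of_lie_eq_zero {V η : VField E M} (hη : ⁅V, η⁆ = 0) {t : ℝ} {x y : M}
    (h : FlowsTo V t x y) (hx : η x = V x) : η y = V y := by
  obtain ⟨U, f, hU, hxU, -, hF, hW⟩ := h.exists_flowMap
  obtain rfl := (hF x hxU).unique h
  rw [← hW _ (isTransported_const hη) x hxU, ← hW _ (isTransported_const (lie_self V)) x hxU, hx]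

theorem mfderiv_of_mem_pseudogroup {η : VField E M} (hη : η ∈ centralizer ζ)
    {φ : OpenPartialHomeomorph M M} (hφ : φ ∈ pseudogroup ζ) {x : M} (hx : x ∈ φ.source) :
    MDifferentiableAt 𝓘(ℝ, E) 𝓘(ℝ, E) φ x ∧
      mfderiv 𝓘(ℝ, E) 𝓘(ℝ, E) φ x (η x) = η (φ x) := by
  obtain ⟨e, he, hxe, h⟩ := hφ.2 x hx
  refine ⟨(he.mdifferentiableAt hxe).congr_of_eventuallyEq h, ?_⟩
  rw [h.mfderiv_eq, h.eq_of_nhds]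
  exact he.mfderiv_of_mem_centralizer hη hxe

/-- Elements of the pseudogroup map the trajectory through the base point of a fundamental field
to trajectories of the field in the centralizer with the same value at the base point. -/
theorem flowsTo_iff_of_mem_centralizer {η : VField E M} (hη : η ∈ centralizer ζ) {X : 𝔤}
    (hX : η x₀ = ζ X x₀) {φ : OpenPartialHomeomorph M M} (hφ : φ ∈ pseudogroup ζ) {c : ℝ → M}
    {t : ℝ} (hc0 : c 0 = x₀)
    (hc : IsMIntegralCurveOn (I := 𝓘(ℝ, E)) c (fun z => ζ X z) (uIcc 0 t))
    (hcφ : ∀ s ∈ uIcc 0 t, c s ∈ φ.source) (y : M) :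
    FlowsTo η t (φ x₀) y ↔ y = φ (c t) := by
  have hflow : FlowsTo η t (φ x₀) (φ (c t)) := by
    refine ⟨φ ∘ c, by rw [Function.comp_apply, hc0], rfl, fun s hs => ?_⟩
    -- Along `c` the two fields coincide, so `c` is a trajectory of `η` as well, and `φ` maps it to
    -- another one because it preserves `η`.
    have h1 : η (c s) = ζ X (c s) := by
      have h2 : FlowsTo (ζ X) (s - 0) (c 0) (c s) :=
        FlowsTo.of_isMIntegralCurveOn hc (uIcc_subset_uIcc_left hs)
      rw [hc0] at h2
      exact h2.eq_of_lie_eq_zero (by rw [← lie_skew, hη X, neg_zero]) hX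
    obtain ⟨h3, h4⟩ := mfderiv_of_mem_pseudogroup hη hφ (hcφ s hs)
    refine (h3.hasMFDerivAt.comp_hasMFDerivWithinAt s (hc s hs)).congr_mfderiv ?_
    refine ContinuousLinearMap.ext fun (r : ℝ) => ?_
    refine Eq.trans ?_ (congrArg (fun w => r • w) h4)
    rw [h1]
    exact (mfderiv 𝓘(ℝ, E) 𝓘(ℝ, E) φ (c s)).map_smul r (ζ X (c s))
  exact ⟨fun h => h.unique hflow, fun h => h ▸ hflow⟩

end DualAction

end GManifold

end

/-! ### Assembly of the main theorem. -/

theorem lemma5p9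
    {E : Type*} [NormedAddCommGroup E] [NormedSpace ℝ E] [FiniteDimensional ℝ E]
    {M : Type*} [TopologicalSpace M] [T2Space M] [ConnectedSpace M]
    [ChartedSpace E M] [IsManifold 𝓘(ℝ, E) ∞ M]
    {𝔤 : Type*} [LieRing 𝔤] [LieAlgebra ℝ 𝔤] [FiniteDimensional ℝ 𝔤]
    (ζ : 𝔤 →ₗ⁅ℝ⁆ GManifold.VField E M)
    (hζ_eff : GManifold.IsEffective ζ) (hζ_trans : GManifold.IsTransitive ζ) (x₀ : M) :
    -- every point is of the form `φ(x₀)`, and `Ad(φ)` is well defined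
    (∀ x : M, ∃ φ : GManifold.germSpace ζ x₀, φ.1.value = x) ∧
    (∀ φ : GManifold.germSpace ζ x₀, ∃! A : 𝔤 ≃ₗ⁅ℝ⁆ 𝔤, GManifold.IsAd ζ φ.1 A) ∧
    -- the dual action consists of vector fields on `P_{x₀}(𝔤)`
    (∀ X : 𝔤, GManifold.IsVFieldP ζ x₀ (GManifold.dualField ζ x₀ X)) ∧
    -- the normalizer `N`, its ideal `J = 𝔤_{x₀}`, and the map on the Weyl algebra `N / J`
    ∃ (N : LieSubalgebra ℝ 𝔤) (J : LieIdeal ℝ N) (ζhat : (N ⧸ J) →ₗ[ℝ] GManifold.VField E M),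
      (N : Set 𝔤) = GManifold.normalizer ζ x₀ ∧
      GManifold.isotropyAlgebra ζ x₀ ≤ N ∧
      (∀ X : N, X ∈ J ↔ (X : 𝔤) ∈ GManifold.isotropyAlgebra ζ x₀) ∧
      -- `ζhat` is an anti-homomorphism, given by `φ(x₀) ↦ Tφ.ζ_X(x₀) = ζ_{Ad(φ)X}(φ(x₀))`
      (∀ a b : N ⧸ J, ζhat ⁅a, b⁆ = -⁅ζhat a, ζhat b⁆) ∧
      (∀ (X : N) (φ : GManifold.germSpace ζ x₀),
        (⟨φ.1.value, ζhat (LieSubmodule.Quotient.mk X) φ.1.value⟩ :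
          TangentBundle 𝓘(ℝ, E) M) = (GManifold.push φ.1 (ζ X)).value ∧
        ζhat (LieSubmodule.Quotient.mk X) φ.1.value = ζ (GManifold.Ad ζ φ.1 X) φ.1.value) ∧
      -- the centralizer is the image of the Weyl algebra
      GManifold.centralizer ζ = Set.range ζhat ∧
      -- and consists of the projections of the projectable fields of the dual action
      GManifold.centralizer ζ =
        {η | ∃ X : 𝔤, GManifold.ProjectsTo ζ x₀ (GManifold.dualField ζ x₀ X) η} ∧
      -- the flow: `Fl_t(φ(x₀)) = φ(Fl^{ζ_X}_t(x₀))`, as long as the trajectory `c` of `x₀`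
      -- stays in the domain of `φ`
      (∀ (X : N), ∀ φ ∈ GManifold.pseudogroup ζ, ∀ (c : ℝ → M) (t : ℝ), c 0 = x₀ →
        IsMIntegralCurveOn (I := 𝓘(ℝ, E)) c (fun z => ζ X z) (Set.uIcc 0 t) →
        (∀ s ∈ Set.uIcc 0 t, c s ∈ φ.source) →
        ∀ y : M, GManifold.FlowsTo (ζhat (LieSubmodule.Quotient.mk X)) t (φ x₀) y ↔
          y = φ (c t)) := by
  open GManifold in
  refine ⟨fun x => ?_, fun φ => ?_, isVFieldP_dualField, ?_⟩
  · obtain ⟨e, he, hx, rfl⟩ := hζ_trans.exists_isFlowComposite x₀ x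
    exact ⟨⟨_, mem_germSpace_iff.mpr ⟨e, he, hx, rfl⟩⟩, rfl⟩
  · exact ⟨_, isAd_ad hζ_trans hζ_eff φ.2, fun A hA =>
      hA.unique hζ_trans hζ_eff φ.2 (isAd_ad hζ_trans hζ_eff φ.2)⟩
  obtain ⟨N, J, ζhat, hN, hJN, hJ, hlie, hζhat⟩ := exists_weylAlgebra hζ_trans hζ_eff x₀
  refine ⟨N, J, ζhat, hN, hJN, hJ, hlie, fun X φ => ?_, ?_, ?_,
    fun X φ hφ c t hc0 hc hcφ y =>
      flowsTo_iff_of_mem_centralizer (hζhat X).1 (hζhat X).2 hφ hc0 hc hcφ y⟩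
  · have h1 := push_value hζ_trans hζ_eff φ.2 X
    have h2 : ζhat (LieSubmodule.Quotient.mk X) φ.1.value = ζ (Ad ζ φ.1 X) φ.1.value := by
      obtain ⟨φ, hφ⟩ := φ
      obtain ⟨e, he, hx, rfl⟩ := mem_germSpace_iff.mp hφ
      have h3 := he.mfderiv_of_mem_centralizer (hζhat X).1 hx
      rw [(hζhat X).2] at h3
      exact h3.symm.trans (Bundle.TotalSpace.mk_injective _ h1)
    exact ⟨by rw [h1, h2], h2⟩
  · ext η
    refine ⟨fun hη => ?_, ?_⟩
    · obtain ⟨X, hX⟩ := hζ_trans x₀ (η x₀)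
      have hXN : X ∈ N := by
        rw [← SetLike.mem_coe, hN]
        exact (mem_normalizer_iff_exists hζ_trans hζ_eff).mpr ⟨η, hη, hX.symm⟩
      exact ⟨LieSubmodule.Quotient.mk (⟨X, hXN⟩ : N), eq_of_mem_centralizer hζ_trans
        (hζhat ⟨X, hXN⟩).1 hη ((hζhat ⟨X, hXN⟩).2.trans hX)⟩
    · rintro ⟨a, rfl⟩
      obtain ⟨X, rfl⟩ := LieSubmodule.Quotient.surjective_mk' J a
      exact (hζhat X).1
  · ext η
    refine ⟨fun hη => ?_, ?_⟩
    · obtain ⟨X, hX⟩ := hζ_trans x₀ (η x₀)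
      refine ⟨X, projectsTo_iff.mpr fun e he hx => ?_⟩
      rw [← he.mfderiv_of_mem_centralizer hη hx]
      exact congrArg _ hX
    · rintro ⟨X, hX⟩
      rw [projectsTo_iff] at hX
      refine mem_centralizer_of_mfderiv fun f hf x hx => ?_
      -- Every point has the form `e x₀`, so projectability along `e` and along `e.trans f` gives
      -- invariance of `η` under `f`.
      obtain ⟨e, he, hxe, rfl⟩ := hζ_trans.exists_isFlowComposite x₀ x
      have hs : x₀ ∈ (e.trans f).source := by
        rw [OpenPartialHomeomorph.trans_source]
        exact ⟨hxe, hx⟩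
      rw [← hX e he hxe, ← he.mfderiv_trans hf hs]
      exact hX _ (.comp _ _ he hf) hs
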